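/- Let $d\ge 1$, let $\mathbb T^d=\mathbb R^d/\mathbb Z^d$ be the standard flat torus, and let $E\ge 1$ be an integer for which the frequency set $\Lambda_E=\{\lambda\in\mathbb Z^d:|\lambda|^2=E\}$ is non-empty; put $\mathcal N=\#\Lambda_E$. Consider the random eigenfunction of the Laplacian on $\mathbb T^d$ (with eigenvalue $4\pi^2E$) $$f(x)=\frac1{\sqrt{2\mathcal N}}\sum_{\lambda\in\Lambda_E}\bigl(b_\lambda\cos 2\pi\langle\lambda,x\rangle-c_\lambda\sin2\pi\langle\lambda,x\rangle\bigr),$$ where the $b_\lambda,c_\lambda$ are standard real Gaussians $N(0,1)$ which are independent save for the relations $b_{-\lambda}=b_\lambda$ and $c_{-\lambda}=-c_\lambda$. Let $Z(f)\in[0,\infty]$ be the $(d-1)$-dimensional volume (Hausdorff measure, in the usual normalisation; the number of points if $d=1$) of the nodal set $\{x\in\mathbb T^d: f(x)=0\}$. Then $Z$ is a random variable (measurable up to a null set), and its expectation is $$\mathbb E(Z)=\mathcal I_d\sqrt E,\qquad \mathcal I_d=\sqrt{\frac{4\pi}{d}}\;\frac{\Gamma\left(\frac{d+1}2\right)}{\Gamma\left(\frac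 d2\right)}.$$ -/

import Mathlib

open MeasureTheory ProbabilityTheory
open scoped ENNReal

namespace ToralNodal

/-- The frequency set `Λ_E = {l ∈ ℤ^d : |l|² = E}`. The enclosing box `[-E, E]^d` only serves to
make the set a `Finset`; see `mem_frequencies`. -/
noncomputable def frequencies (d E : ℕ) : Finset (Fin d → ℤ) :=
  (Fintype.piFinset fun _ : Fin d => Finset.Icc (-(E : ℤ)) (E : ℤ)).filter
    fun l => ∑ i, l i ^ 2 = (E : ℤ)

theorem mem_frequencies {d E : ℕ} {l : Fin d → ℤ} :
    l ∈ frequencies d E ↔ ∑ i, l i ^ 2 = (E : ℤ) := by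
  simp only [frequencies, Finset.mem_filter, Fintype.mem_piFinset, Finset.mem_Icc,
    and_iff_right_iff_imp]
  intro h i
  have h1 : l i ^ 2 ≤ (E : ℤ) := by
    rw [← h]
    exact Finset.single_le_sum (f := fun j => l j ^ 2) (fun j _ => sq_nonneg (l j))
      (Finset.mem_univ i)
  have h2 := Int.le_self_sq (l i)
  have h3 := Int.le_self_sq (-l i)
  rw [neg_sq] at h3
  constructor <;> linarith

/-- The pairing `⟨l, x⟩ = ∑ l_i x_i` of a frequency with a point of `ℝ^d`. -/
noncomputable def pairing {d : ℕ} (l : Fin d → ℤ) (x : EuclideanSpace ℝ (Fin d)) : ℝ :=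
  ∑ i, (l i : ℝ) * x i

/-- The function
`f(x) = (2𝒩)^{-1/2} ∑_{|l|² = E} (b_l cos 2π⟨l, x⟩ - c_l sin 2π⟨l, x⟩)`, with `𝒩 = #Λ_E`, written
as a `ℤ^d`-periodic function on `ℝ^d`. -/
noncomputable def eigenfunction (d E : ℕ) (b c : (Fin d → ℤ) → ℝ)
    (x : EuclideanSpace ℝ (Fin d)) : ℝ :=
  1 / √(2 * ((frequencies d E).card : ℝ)) *
    ∑ l ∈ frequencies d E,
      (b l * Real.cos (2 * Real.pi * pairing l x) - c l * Real.sin (2 * Real.pi * pairing l x))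

/-- The standard flat torus `𝕋^d = ℝ^d / ℤ^d`: the `d`-fold product of `ℝ / ℤ` with the Euclidean
(`ℓ²`) product distance, which is the distance induced from `ℝ^d`. -/
abbrev FlatTorus (d : ℕ) : Type := PiLp 2 fun _ : Fin d => UnitAddCircle

/-- The quotient map `ℝ^d → ℝ^d / ℤ^d`. -/
def toTorus {d : ℕ} (x : EuclideanSpace ℝ (Fin d)) : FlatTorus d :=
  WithLp.toLp 2 fun i => ((x i : ℝ) : UnitAddCircle)

/-- The nodal set, in the torus, of the function with coefficients `b`, `c`. -/
def nodalSet (d E : ℕ) (b c : (Fin d → ℤ) → ℝ) : Set (FlatTorus d) :=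
  toTorus '' {x : EuclideanSpace ℝ (Fin d) | eigenfunction d E b c x = 0}

/-- The `(d-1)`-dimensional volume `Z(f)` of the nodal set: its `(d-1)`-dimensional Hausdorff
measure, normalised so that it agrees with Lebesgue measure on `ℝ^(d-1)` (for `d = 1` it is the
number of zeros on the circle). -/
noncomputable def nodalVolume (d E : ℕ) (b c : (Fin d → ℤ) → ℝ) : ℝ≥0∞ :=
  Measure.euclideanHausdorffMeasure (d - 1) (nodalSet d E b c)

/-- The coefficients of a random eigenfunction: `b_l, c_l ∼ N(0, 1)`, `l ∈ Λ_E`, are independent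
save for the relations `b_{-l} = b_l` and `c_{-l} = -c_l`; that is, over any set of frequencies
which contains no two opposite ones, all the `b_l` and `c_l` are jointly independent. -/
structure IsGaussianCoefficients {Ω : Type*} [MeasurableSpace Ω] (P : Measure Ω) (d E : ℕ)
    (b c : (Fin d → ℤ) → Ω → ℝ) : Prop where
  law_b : ∀ l ∈ frequencies d E, HasLaw (b l) (gaussianReal 0 1) P
  law_c : ∀ l ∈ frequencies d E, HasLaw (c l) (gaussianReal 0 1) P
  b_neg : ∀ l ∈ frequencies d E, ∀ ω, b (-l) ω = b l ω
  c_neg : ∀ l ∈ frequencies d E, ∀ ω, c (-l) ω = -c l ω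
  indep : ∀ H ⊆ frequencies d E, (∀ l ∈ H, -l ∉ H) →
    iIndepFun (fun i : H ⊕ H => Sum.elim (fun l : H => b l) (fun l : H => c l) i) P

/-- The constant `𝓘_d = √(4π/d) Γ((d+1)/2) / Γ(d/2)`. -/
noncomputable def nodalConstant (d : ℕ) : ℝ :=
  √(4 * Real.pi / d) * (Real.Gamma (((d : ℝ) + 1) / 2) / Real.Gamma ((d : ℝ) / 2))

end ToralNodal

/-! This is the Kac–Rice formula, arranged so that only one frequency needs analysis. Keep one
frequency out of each opposite pair: the zeros of `f` are those of a wave `∑ (b_i cos⟨l_i, x⟩ - c_i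
sin⟨l_i, x⟩)` with `n = 𝒩 / 2` independent pairs `(b_i, c_i)`. Freeze everything except `b_0`. Where
`cos⟨l_0, x⟩ ≠ 0`, the zero set is the level set at height `b_0` of a `C¹` quotient, and the coarea
formula `lintegral_coarea` turns the mean over `b_0` into a volume integral of a Gaussian density
times a gradient norm. Averaging over `c_0` as well and rotating the `(b_0, c_0)`-plane removes the
cosine from the denominator (`lintegral_gaussian_line`). Where the cosine is small, the sine takes
its place.

For fixed `x`, rotating each remaining pair by the angle `⟨l_i, x⟩` preserves its law, and turns the
value and the gradient of the remaining wave into the independent sums `∑ b_i` and `∑ c_i l_i`. The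
integrand therefore does not depend on `x`: it is the density `(2πn)^(-1/2)` of the full wave at `0`
times the mean of `‖∑ c_i l_i‖` (`lintegral_zeros_wave`). As `Λ_E` is invariant under permutations
and sign changes of the coordinates, this Gaussian vector is isotropic, with standard deviation
`2π√(nE/d)` in each direction. The mean norm of a standard Gaussian vector supplies the Gamma
factors, and `n` cancels.

The coarea formula is proved by straightening level sets into hyperplanes on small pieces, with
Eilenberg's inequality for the critical set. Measurability of `Z` holds because zero sets in a
compact set vary upper semicontinuously with the coefficients. -/

namespace ToralNodal

open Metric Filter Topology Set NNReal

/-! ### Hausdorff measure: measurability in parameters and Eilenberg's inequality -/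

section Hausdorff

variable {X : Type*} [EMetricSpace X] [MeasurableSpace X] [BorelSpace X]

/-- A countable cover can be replaced by an open cover, at an arbitrarily small cost. -/
theorem exists_open_superset_ediam_rpow_le {Y : Type*} [PseudoEMetricSpace Y] {s : ℝ} (hs : 0 ≤ s)
    {S : Set Y} {r ε : ℝ≥0∞} (hS : ediam S < r) (hε : ε ≠ 0) :
    ∃ V, IsOpen V ∧ S ⊆ V ∧ ediam V ≤ r ∧ ediam V ^ s ≤ ediam S ^ s + ε := by
  have hc : Tendsto (fun δ : ℝ≥0∞ => ediam S + 2 * δ) (𝓝 0) (𝓝 (ediam S)) := by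
    have : Tendsto (fun δ : ℝ≥0∞ => ediam S + 2 * δ) (𝓝 0) (𝓝 (ediam S + 2 * 0)) :=
      tendsto_const_nhds.add (ENNReal.Tendsto.const_mul tendsto_id (Or.inr (by simp)))
    simpa using this
  have hc' : Tendsto (fun δ : ℝ≥0∞ => (ediam S + 2 * δ) ^ s) (𝓝 0) (𝓝 (ediam S ^ s)) :=
    (ENNReal.continuous_rpow_const.tendsto _).comp hc
  have hfin : ediam S ^ s ≠ ∞ := ENNReal.rpow_ne_top_of_nonneg hs (hS.trans_le le_top).ne
  have h1 := hc.eventually (gt_mem_nhds hS)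
  have h2 := hc'.eventually (gt_mem_nhds (ENNReal.lt_add_right hfin hε))
  obtain ⟨δ, ⟨h1, h2⟩, h0 : 0 < δ, h3⟩ := (((h1.and h2).filter_mono nhdsWithin_le_nhds).and
    (Ioo_mem_nhdsGT (zero_lt_one : (0:ℝ≥0∞) < 1))).exists
  have hδ : δ ≠ ∞ := (h3.trans ENNReal.one_lt_top).ne
  have hpos : 0 < δ.toReal := ENNReal.toReal_pos h0.ne' hδ
  have hd : ediam (thickening δ.toReal S) ≤ ediam S + 2 * δ := by
    have := ediam_thickening_le (s := S) (δ.toNNReal)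
    rwa [ENNReal.coe_toNNReal hδ] at this
  exact ⟨thickening δ.toReal S, isOpen_thickening, self_subset_thickening hpos S,
    hd.trans h1.le, (ENNReal.rpow_le_rpow hd hs).trans h2.le⟩

theorem exists_cover_of_hausdorffMeasure_lt {s : ℝ} {S : Set X} {c r : ℝ≥0∞} (hr : 0 < r)
    (h : μH[s] S < c) : ∃ t : ℕ → Set X, S ⊆ ⋃ n, t n ∧ (∀ n, ediam (t n) ≤ r) ∧
      ∑' n, ⨆ _ : (t n).Nonempty, ediam (t n) ^ s < c := by
  rw [Measure.hausdorffMeasure_apply] at h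
  have h1 := (le_iSup₂ (f := fun (r : ℝ≥0∞) (_ : 0 < r) =>
    ⨅ (t : ℕ → Set X) (_ : S ⊆ ⋃ n, t n) (_ : ∀ n, ediam (t n) ≤ r),
      ∑' n, ⨆ _ : (t n).Nonempty, ediam (t n) ^ s) r hr).trans_lt h
  simp only [iInf_lt_iff] at h1
  obtain ⟨t, h2, h3, h4⟩ := h1
  exact ⟨t, h2, h3, h4⟩

theorem hausdorffMeasure_le_of_forall_cover {s : ℝ} {S : Set X} {c : ℝ≥0∞}
    (h : ∀ r : ℝ≥0∞, 0 < r → ∀ ε : ℝ≥0∞, 0 < ε → ∃ t : ℕ → Set X, S ⊆ ⋃ n, t n ∧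
      (∀ n, ediam (t n) ≤ r) ∧ ∑' n, (⨆ _ : (t n).Nonempty, ediam (t n) ^ s) ≤ c + ε) :
    μH[s] S ≤ c := by
  rw [Measure.hausdorffMeasure_apply]
  refine iSup₂_le fun r hr => ENNReal.le_of_forall_pos_le_add fun ε hε _ => ?_
  obtain ⟨t, h1, h2, h3⟩ := h r hr ε (by exact_mod_cast hε)
  exact (iInf₂_le_of_le t h1 (iInf_le_of_le h2 le_rfl)).trans h3

/-- The Hausdorff measure of an upper semicontinuous family of sets is a measurable function. -/
theorem measurable_hausdorffMeasure_of_isOpen {Θ : Type*} [TopologicalSpace Θ] [MeasurableSpace Θ]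
    [OpensMeasurableSpace Θ] {s : ℝ} (hs : 0 ≤ s) (Z : Θ → Set X)
    (hZ : ∀ V, IsOpen V → IsOpen {p | Z p ⊆ V}) : Measurable fun p => μH[s] (Z p) := by
  refine measurable_of_Iic fun c => ?_
  by_cases hc : c = ∞
  · simp [hc]
  let r : ℕ → ℝ≥0∞ := fun n => ((n : ℝ≥0∞) + 1)⁻¹
  have hr0 : ∀ n, 0 < r n := fun n => by simp [r]
  have hrt : ∀ n, r n ≠ ∞ := fun n => by simp [r]
  have hrlim : ∀ ε : ℝ≥0∞, 0 < ε → ∃ n, r n ≤ ε := fun ε hε => by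
    obtain ⟨n, hn⟩ := ENNReal.exists_inv_nat_lt hε.ne'
    exact ⟨n, (ENNReal.inv_le_inv.2 le_self_add).trans hn.le⟩
  -- `G n` collects the parameters whose set has an open cover of mesh `r n` and cost at most `c + r
  -- n`. It is a union of open sets, and the measure is at most `c` exactly on the intersection of
  -- the `G n`.
  let G : ℕ → Set Θ := fun n => ⋃ (t : ℕ → Set X) (_ : (∀ i, IsOpen (t i)) ∧
    (∀ i, ediam (t i) ≤ r n) ∧ ∑' i, (⨆ _ : (t i).Nonempty, ediam (t i) ^ s) ≤ c + r n),
    {p | Z p ⊆ ⋃ i, t i}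
  have hG : (fun p => μH[s] (Z p)) ⁻¹' Iic c = ⋂ n, G n := by
    ext p
    simp only [mem_preimage, mem_Iic, mem_iInter, G, mem_iUnion, mem_ofPred_eq, exists_prop]
    constructor
    · intro h n
      have h1 : μH[s] (Z p) < c + r n / 2 := h.trans_lt
        (ENNReal.lt_add_right hc (ENNReal.half_pos (hr0 n).ne').ne')
      obtain ⟨t, ht1, ht2, ht3⟩ := exists_cover_of_hausdorffMeasure_lt
        (ENNReal.half_pos (hr0 n).ne') h1
      obtain ⟨e, he0, he⟩ := ENNReal.exists_pos_sum_of_countable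
        (ENNReal.half_pos (hr0 n).ne').ne' ℕ
      have hV : ∀ i, ∃ V, IsOpen V ∧ t i ⊆ V ∧ ediam V ≤ r n ∧
          (⨆ _ : V.Nonempty, ediam V ^ s) ≤ (⨆ _ : (t i).Nonempty, ediam (t i) ^ s) + e i := by
        intro i
        rcases (t i).eq_empty_or_nonempty with h0 | h0
        · exact ⟨∅, isOpen_empty, by simp [h0], by simp, by simp⟩
        obtain ⟨V, hV1, hV2, hV3, hV4⟩ := exists_open_superset_ediam_rpow_le hs
          ((ht2 i).trans_lt (ENNReal.half_lt_self (hr0 n).ne' (hrt n)))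
          (ε := e i) (by exact_mod_cast (he0 i).ne')
        exact ⟨V, hV1, hV2, hV3, by simpa [h0, h0.mono hV2] using hV4⟩
      choose V hV1 hV2 hV3 hV4 using hV
      refine ⟨V, ⟨hV1, hV3, ?_⟩, ht1.trans (iUnion_mono hV2)⟩
      calc _ ≤ ∑' i, ((⨆ _ : (t i).Nonempty, ediam (t i) ^ s) + e i) := ENNReal.tsum_le_tsum hV4
        _ = _ := ENNReal.tsum_add
        _ ≤ (c + r n / 2) + r n / 2 := add_le_add ht3.le he.le
        _ = c + r n := by rw [add_assoc, ENNReal.add_halves]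
    · intro h
      refine hausdorffMeasure_le_of_forall_cover fun ρ hρ ε hε => ?_
      obtain ⟨n, hn⟩ := hrlim (min ρ ε) (lt_min hρ hε)
      obtain ⟨t, ⟨-, h2, h3⟩, h4⟩ := h n
      exact ⟨t, h4, fun i => (h2 i).trans (hn.trans (min_le_left _ _)), h3.trans
        (add_le_add_right (hn.trans (min_le_right _ _)) c)⟩
  rw [hG]
  refine MeasurableSet.iInter fun n => IsOpen.measurableSet ?_
  exact isOpen_biUnion fun t ht => hZ _ (isOpen_iUnion ht.1)

/-- Zero sets of a jointly continuous function in a compact set. -/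
theorem measurable_hausdorffMeasure_zeros_of_isCompact {Θ : Type*} [TopologicalSpace Θ]
    [MeasurableSpace Θ] [OpensMeasurableSpace Θ] {s : ℝ} (hs : 0 ≤ s) {K : Set X}
    (hK : IsCompact K) {F : Θ → X → ℝ} (hF : Continuous fun q : Θ × X => F q.1 q.2) :
    Measurable fun p => μH[s] (K ∩ {x | F p x = 0}) := by
  refine measurable_hausdorffMeasure_of_isOpen hs _ fun V hV => ?_
  have hKV : IsCompact (K \ V) := hK.diff hV
  have h : IsOpen {p | ∀ x ∈ K \ V, F p x ≠ 0} := by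
    refine isOpen_iff_mem_nhds.2 fun p hp => ?_
    -- Tube lemma: nonvanishing on the compact set `K \ V` persists under small changes of the
    -- parameter.
    refine hKV.eventually_forall_of_forall_eventually fun x hx => ?_
    exact (hF.continuousAt (x := (p, x))).eventually_ne (hp x hx)
  convert h using 3 with p
  constructor
  · rintro h x ⟨h1, h2⟩ h3
    exact h2 (h ⟨h1, h3⟩)
  · rintro h x ⟨h1, h2⟩
    by_contra h3
    exact h x ⟨h1, h3⟩ h2

/-- Meant for the half-open cube and for pieces cut out by strict inequalities, which are not
compact; continuity from below reduces them to compact sets. -/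
theorem measurable_euclideanHausdorffMeasure_zeros {Θ : Type*} [TopologicalSpace Θ]
    [MeasurableSpace Θ] [OpensMeasurableSpace Θ] (k : ℕ) {K : ℕ → Set X} (hKm : Monotone K)
    (hK : ∀ n, IsCompact (K n)) {F : Θ → X → ℝ} (hF : Continuous fun q : Θ × X => F q.1 q.2) :
    Measurable fun p => Measure.euclideanHausdorffMeasure k ((⋃ n, K n) ∩ {x | F p x = 0}) := by
  have h : ∀ p, Measure.euclideanHausdorffMeasure k ((⋃ n, K n) ∩ {x | F p x = 0}) =
      ⨆ n, Measure.euclideanHausdorffMeasure k (K n ∩ {x | F p x = 0}) := fun p => by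
    rw [iUnion_inter]
    exact Monotone.measure_iUnion fun i j hij => inter_subset_inter_left _ (hKm hij)
  simp_rw [h]
  refine Measurable.iSup fun n => ?_
  simp_rw [Measure.euclideanHausdorffMeasure_def, Measure.smul_apply]
  exact (measurable_hausdorffMeasure_zeros_of_isCompact (Nat.cast_nonneg k) (hK n) hF).const_smul _

/-- Eilenberg's inequality: slices of a set by the level sets of a Lipschitz function. -/
theorem exists_measurable_hausdorffMeasure_inter_preimage_le {s : ℝ} (hs : 0 ≤ s) {Z : Set X}
    {u : X → ℝ} {K : NNReal} (hu : LipschitzOnWith K u Z) (hZ : μH[s + 1] Z ≠ ∞) :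
    ∃ m : ℝ → ℝ≥0∞, Measurable m ∧ (∀ t, μH[s] (Z ∩ u ⁻¹' {t}) ≤ m t) ∧
      ∫⁻ t, m t ≤ K * μH[s + 1] Z := by
  let r : ℕ → ℝ≥0∞ := fun n => ((n : ℝ≥0∞) + 1)⁻¹
  have hr0 : ∀ n, 0 < r n := fun n => by simp [r]
  have hrlim : Tendsto r atTop (𝓝 0) := by
    have := (ENNReal.tendsto_inv_nat_nhds_zero).comp (tendsto_add_atTop_nat 1)
    simpa [r, Function.comp_def] using this
  choose S hS1 hS2 hS3 using fun n => exists_cover_of_hausdorffMeasure_lt (hr0 n)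
    (ENNReal.lt_add_right hZ (hr0 n).ne')
  -- The images `u '' (S n i ∩ Z)` need not be Borel; their closures are, and have the same
  -- diameter.
  let m : ℕ → ℝ → ℝ≥0∞ := fun n t => ∑' i, (closure (u '' (S n i ∩ Z))).indicator
    (fun _ => ediam (S n i ∩ Z) ^ s) t
  have hm : ∀ n, Measurable (m n) := fun n => Measurable.tsum fun i =>
    measurable_const.indicator isClosed_closure.measurableSet
  refine ⟨fun t => liminf (fun n => m n t) atTop, Measurable.liminf hm, fun t => ?_, ?_⟩
  · let ι : ℕ → Type := fun n => {i : ℕ // t ∈ u '' (S n i ∩ Z)}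
    refine (Measure.hausdorffMeasure_le_liminf_tsum (ι := ι) s _ r hrlim
      (fun n i => S n i ∩ Z ∩ u ⁻¹' {t}) (Eventually.of_forall fun n i => ?_)
      (Eventually.of_forall fun n x hx => ?_)).trans ?_
    · exact (ediam_mono (inter_subset_left.trans inter_subset_left)).trans (hS2 n i)
    · obtain ⟨i, hi⟩ := mem_iUnion.1 (hS1 n hx.1)
      exact mem_iUnion.2 ⟨⟨i, x, ⟨hi, hx.1⟩, hx.2⟩, ⟨hi, hx.1⟩, hx.2⟩
    · refine liminf_le_liminf (Eventually.of_forall fun n => ?_)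
      refine le_trans ?_ (ENNReal.tsum_comp_le_tsum_of_injective
        (Subtype.val_injective (p := fun i => t ∈ u '' (S n i ∩ Z))) _)
      refine ENNReal.tsum_le_tsum fun i => ?_
      rw [indicator_of_mem (subset_closure i.2)]
      exact ENNReal.rpow_le_rpow (ediam_mono inter_subset_left) hs
  · have hI : ∀ n, ∫⁻ t, m n t ≤ K * (μH[s + 1] Z + r n) := by
      intro n
      rw [lintegral_tsum fun i =>
        (measurable_const.indicator isClosed_closure.measurableSet).aemeasurable]
      refine le_trans (ENNReal.tsum_le_tsum fun i => ?_) (le_of_eq_of_le ENNReal.tsum_mul_left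
        (mul_le_mul_right (hS3 n).le _))
      rw [lintegral_indicator_const isClosed_closure.measurableSet]
      rcases (S n i ∩ Z).eq_empty_or_nonempty with h0 | h0
      · simp [h0]
      -- A set of reals has measure at most its diameter, which accounts for one of the `s + 1`
      -- powers of the diameter.
      have h1 : volume (closure (u '' (S n i ∩ Z))) ≤ K * ediam (S n i ∩ Z) := by
        refine (Real.volume_le_diam _).trans ?_
        rw [ediam_closure]
        exact ediam_image_le_iff.2 fun x hx y hy => (hu hx.2 hy.2).trans
          (mul_le_mul_right (edist_le_ediam_of_mem hx hy) _)
      simp only [h0.mono inter_subset_left, iSup_pos]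
      calc _ ≤ ediam (S n i ∩ Z) ^ s * (K * ediam (S n i ∩ Z)) := mul_le_mul_right h1 _
        _ = K * ediam (S n i ∩ Z) ^ (s + 1) := by
          rw [ENNReal.rpow_add_of_nonneg _ _ hs zero_le_one, ENNReal.rpow_one]; ring
        _ ≤ _ := mul_le_mul_right
          (ENNReal.rpow_le_rpow (ediam_mono inter_subset_left) (by linarith)) _
    refine (lintegral_liminf_le hm).trans ?_
    have hlim : Tendsto (fun n => (K : ℝ≥0∞) * (μH[s + 1] Z + r n)) atTop
        (𝓝 (K * (μH[s + 1] Z + 0))) :=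
      ENNReal.Tendsto.const_mul (tendsto_const_nhds.add hrlim) (Or.inr ENNReal.coe_ne_top)
    rw [add_zero] at hlim
    exact (liminf_le_liminf (Eventually.of_forall hI)).trans hlim.liminf_eq.le

end Hausdorff

/-! ### Slices by hyperplanes, and straightening of level sets -/

theorem euclideanHausdorffMeasure_image_le {X Y : Type*} [EMetricSpace X] [MeasurableSpace X]
    [BorelSpace X] [EMetricSpace Y] [MeasurableSpace Y] [BorelSpace Y] {K : ℝ≥0} {f : X → Y}
    {S : Set X} (hf : LipschitzOnWith K f S) (k : ℕ) :
    Measure.euclideanHausdorffMeasure k (f '' S) ≤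
      (K : ℝ≥0∞) ^ k * Measure.euclideanHausdorffMeasure k S := by
  simp_rw [Measure.euclideanHausdorffMeasure_def, Measure.smul_apply, ENNReal.smul_def, smul_eq_mul]
  rw [mul_left_comm]
  refine mul_le_mul_right ?_ _
  simpa using hf.hausdorffMeasure_image_le (Nat.cast_nonneg k)

section Coarea

variable {V : Type*} [NormedAddCommGroup V] [InnerProductSpace ℝ V] [FiniteDimensional ℝ V]
  [MeasurableSpace V] [BorelSpace V] {k : ℕ}

/-- Each slice is isometric to a section of a Borel subset of `ℝ × W`, where `W` is the hyperplane
orthogonal to `v`, so Fubini's theorem applies. -/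
theorem measurable_euclideanHausdorffMeasure_slice (hk : Module.finrank ℝ V = k + 1) {v : V}
    (hv : v ≠ 0) {B : Set V} (hB : MeasurableSet B) :
    Measurable fun t : ℝ => Measure.euclideanHausdorffMeasure k (B ∩ {y | inner ℝ v y = t}) := by
  let w : V := (‖v‖ ^ 2)⁻¹ • v
  have hvw : inner ℝ v w = 1 := by
    rw [inner_smul_right, real_inner_self_eq_norm_sq, inv_mul_cancel₀]
    exact pow_ne_zero _ (norm_ne_zero_iff.2 hv)
  let W := (ℝ ∙ v)ᗮ
  have hW : Module.finrank ℝ W = k := by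
    have := (ℝ ∙ v).finrank_add_finrank_orthogonal
    rw [finrank_span_singleton hv, hk] at this
    change Module.finrank ℝ (ℝ ∙ v)ᗮ = k
    omega
  have hι : ∀ t : ℝ, Isometry fun z : W => t • w + (z : V) := fun t => by
    refine Isometry.of_dist_eq fun a b => ?_
    simp [dist_eq_norm]
  have hr : ∀ t : ℝ, range (fun z : W => t • w + (z : V)) = {y | inner ℝ v y = t} := fun t => by
    ext y
    simp only [mem_range, mem_ofPred_eq]
    constructor
    · rintro ⟨z, rfl⟩
      rw [inner_add_right, inner_smul_right, hvw,
        Submodule.mem_orthogonal_singleton_iff_inner_right.1 z.2]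
      ring
    · intro h
      refine ⟨⟨y - t • w, Submodule.mem_orthogonal_singleton_iff_inner_right.2 ?_⟩, by simp⟩
      rw [inner_sub_right, inner_smul_right, hvw, h]
      ring
  have h : ∀ t : ℝ, Measure.euclideanHausdorffMeasure k (B ∩ {y | inner ℝ v y = t}) =
      (volume : Measure W) (Prod.mk t ⁻¹' ((fun q : ℝ × W => q.1 • w + (q.2 : V)) ⁻¹' B)) := by
    intro t
    rw [← hr, ← (hι t).euclideanHausdorffMeasure_preimage, ← hW,
      InnerProductSpace.euclideanHausdorffMeasure_eq_volume]
    rfl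
  simp_rw [h]
  exact measurable_measure_prodMk_left (hB.preimage (by fun_prop))

/-- Fubini's theorem for the slices of a set by parallel hyperplanes. -/
theorem lintegral_euclideanHausdorffMeasure_slice (hk : Module.finrank ℝ V = k + 1) {v : V}
    (hv : v ≠ 0) {B : Set V} (hB : MeasurableSet B) {η : ℝ → ℝ≥0∞} (hη : Measurable η) :
    ∫⁻ t, η t * Measure.euclideanHausdorffMeasure k (B ∩ {y | inner ℝ v y = t}) =
      ‖v‖ₑ * ∫⁻ y in B, η (inner ℝ v y) := by
  have hv' : ‖v‖ ≠ 0 := norm_ne_zero_iff.2 hv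
  have hmeas : Measurable fun y : V => inner ℝ v y := by fun_prop
  have key : (volume : Measure ℝ).withDensity
      (fun t => Measure.euclideanHausdorffMeasure k (B ∩ {y | inner ℝ v y = t})) =
      ‖v‖ₑ • (volume.restrict B).map (fun y => inner ℝ v y) := by
    ext J hJ
    -- With `⟨v, w⟩ = 1`, the hyperplane through `t • w` is `{⟨v, y⟩ = t}`; the Jacobian factor
    -- `‖w‖` of this parametrisation cancels `‖v‖`.
    let w : V := (‖v‖ ^ 2)⁻¹ • v
    have hw : w ≠ 0 := smul_ne_zero (inv_ne_zero (pow_ne_zero _ hv')) hv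
    have hwn : ‖v‖ₑ * ‖w‖ₑ = 1 := by
      rw [← enorm_norm v, ← enorm_norm w, ← enorm_mul, norm_smul]
      rw [norm_inv, norm_pow, norm_norm]
      have : ‖v‖ * ((‖v‖ ^ 2)⁻¹ * ‖v‖) = 1 := by field_simp
      rw [this]; simp
    have hvw : inner ℝ v w = 1 := by
      rw [inner_smul_right, real_inner_self_eq_norm_sq, inv_mul_cancel₀]
      exact pow_ne_zero _ hv'
    have hmk : ∀ t : ℝ, ((AffineSubspace.mk' (t • w +ᵥ (0 : V)) (ℝ ∙ w)ᗮ : AffineSubspace ℝ V) :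
        Set V) = {y | inner ℝ v y = t} := by
      intro t
      ext y
      have hspan : (ℝ ∙ w) = (ℝ ∙ v) :=
        Submodule.span_singleton_smul_eq (IsUnit.mk0 _ (inv_ne_zero (pow_ne_zero _ hv'))) v
      rw [SetLike.mem_coe, AffineSubspace.mem_mk', hspan,
        Submodule.mem_orthogonal_singleton_iff_inner_right]
      simp only [vadd_eq_add, add_zero, vsub_eq_sub, inner_sub_right, inner_smul_right, hvw,
        mem_ofPred_eq]
      constructor <;> intro h <;> linarith
    have h0 := EuclideanGeometry.euclideanHausdorffMeasure_eq_lintegral (0 : V) hw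
      (hB.inter (hmeas hJ))
    rw [InnerProductSpace.euclideanHausdorffMeasure_eq_volume, hk, Nat.add_sub_cancel] at h0
    simp_rw [hmk] at h0
    rw [withDensity_apply _ hJ, Measure.smul_apply, Measure.map_apply hmeas hJ,
      Measure.restrict_apply (hmeas hJ), inter_comm _ B, h0, smul_eq_mul, ← mul_assoc, hwn,
      one_mul, ← lintegral_indicator hJ]
    refine lintegral_congr fun t => ?_
    by_cases ht : t ∈ J
    · rw [indicator_of_mem ht]
      congr 1
      ext y
      simp only [mem_inter_iff, mem_ofPred_eq, mem_preimage]
      constructor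
      · rintro ⟨h1, h2⟩; exact ⟨⟨h1, h2 ▸ ht⟩, h2⟩
      · rintro ⟨⟨h1, -⟩, h2⟩; exact ⟨h1, h2⟩
    · rw [indicator_of_notMem ht, eq_comm]
      convert measure_empty (μ := (Measure.euclideanHausdorffMeasure k : Measure V))
      rw [eq_empty_iff_forall_notMem]
      rintro y ⟨⟨-, h1⟩, h2 : inner ℝ v y = t⟩
      exact ht (h2 ▸ h1)
  have h1 := congrArg (fun μ => ∫⁻ t, η t ∂μ) key
  rw [lintegral_withDensity_eq_lintegral_mul _
    (measurable_euclideanHausdorffMeasure_slice hk hv hB) hη, lintegral_smul_measure,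
    lintegral_map hη hmeas, smul_eq_mul] at h1
  rw [← h1]
  exact lintegral_congr fun t => mul_comm _ _

/-- Comparison of the level sets of a function which is close to a linear form with the slices of
a set by hyperplanes. -/
theorem exists_slice_comparison (hk : Module.finrank ℝ V = k + 1) {u : V → ℝ} {v : V} (hv : v ≠ 0)
    {κ : ℝ≥0} (hκ : 1 ≤ κ) {D A : Set V} (hD : Convex ℝ D) (hA : MeasurableSet A) (hAD : A ⊆ D)
    (hu : ∀ x ∈ D, DifferentiableAt ℝ u x)
    (hu' : ∀ x ∈ D, ‖fderiv ℝ u x - innerSL ℝ v‖ ≤ (1 - (κ : ℝ)⁻¹) * ‖v‖) :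
    ∃ m : ℝ → ℝ≥0∞, Measurable m ∧
      (∀ t, m t ≤ κ ^ k * Measure.euclideanHausdorffMeasure k (A ∩ u ⁻¹' {t})) ∧
      (∀ t, Measure.euclideanHausdorffMeasure k (A ∩ u ⁻¹' {t}) ≤ κ ^ k * m t) ∧
      ∀ η : ℝ → ℝ≥0∞, Measurable η →
        ∫⁻ t, η t * m t ≤ ∫⁻ x in A, η (u x) * ‖fderiv ℝ u x‖ₑ ∧
        ∫⁻ x in A, η (u x) * ‖fderiv ℝ u x‖ₑ ≤ κ ^ 2 * ∫⁻ t, η t * m t := by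
  have hv' : 0 < ‖v‖ := norm_pos_iff.2 hv
  have hκ0 : (1 : ℝ) ≤ κ := by exact_mod_cast hκ
  -- This value gives both `κ (1 - ε) = 1` and `1 + ε ≤ κ`, so a perturbation of the identity of
  -- Lipschitz size `ε` is `κ`-bi-Lipschitz.
  obtain ⟨ε, hε⟩ : ∃ ε : ℝ, ε = 1 - (κ : ℝ)⁻¹ := ⟨_, rfl⟩
  rw [← hε] at hu'
  have hκε : (κ : ℝ) * (1 - ε) = 1 := by rw [hε]; field_simp; ring
  have hε0 : 0 ≤ ε := by rw [hε, sub_nonneg]; exact inv_le_one_of_one_le₀ hκ0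
  have hε1 : 0 < 1 - ε := by rw [hε]; simp; linarith
  have hεκ : 1 + ε ≤ κ := by nlinarith
  obtain ⟨w, hw⟩ : ∃ w : V, w = (‖v‖ ^ 2)⁻¹ • v := ⟨_, rfl⟩
  have hwn : ‖w‖ = ‖v‖⁻¹ := by
    rw [hw, norm_smul, norm_inv, norm_pow, norm_norm]; field_simp
  have hvw : inner ℝ v w = 1 := by
    rw [hw, inner_smul_right, real_inner_self_eq_norm_sq, inv_mul_cancel₀ (by positivity)]
  -- `Φ` moves each point along `w` until the linear form `⟨v, ·⟩` takes the value `u x`, so it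
  -- carries level sets of `u` into hyperplanes.
  let Φ : V → V := fun x => x + (u x - inner ℝ v x) • w
  have hΦv : ∀ x, inner ℝ v (Φ x) = u x := fun x => by
    simp only [Φ, inner_add_right, inner_smul_right, hvw]; ring
  have hg : ∀ x ∈ D, ∀ y ∈ D, ‖(u x - inner ℝ v x) - (u y - inner ℝ v y)‖ ≤ ε * ‖v‖ * ‖x - y‖ := by
    intro x hx y hy
    refine hD.norm_image_sub_le_of_norm_hasFDerivWithin_le
      (f := fun x => u x - inner ℝ v x) (f' := fun x => fderiv ℝ u x - innerSL ℝ v)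
      (fun z hz => ?_) hu' hy hx
    exact ((hu z hz).hasFDerivAt.sub (innerSL ℝ v).hasFDerivAt).hasFDerivWithinAt
  have hsub : ∀ x y, Φ x - Φ y =
      (x - y) + ((u x - inner ℝ v x) - (u y - inner ℝ v y)) • w := fun x y => by
    simp only [Φ, sub_smul]; abel
  have hnorm : ∀ x ∈ D, ∀ y ∈ D,
      ‖((u x - inner ℝ v x) - (u y - inner ℝ v y)) • w‖ ≤ ε * ‖x - y‖ := fun x hx y hy => by
    rw [norm_smul, hwn]
    refine (mul_le_mul_of_nonneg_right (hg x hx y hy) (inv_nonneg.2 hv'.le)).trans_eq ?_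
    field_simp
  have hlip : LipschitzOnWith κ Φ D := LipschitzOnWith.of_dist_le_mul fun x hx y hy => by
    rw [dist_eq_norm, dist_eq_norm, hsub]
    refine (norm_add_le _ _).trans ?_
    have := hnorm x hx y hy
    nlinarith [norm_nonneg (x - y)]
  have hanti : ∀ x ∈ D, ∀ y ∈ D, ‖x - y‖ ≤ κ * ‖Φ x - Φ y‖ := fun x hx y hy => by
    have h1 := hnorm x hx y hy
    have h2 : ‖x - y‖ ≤ ‖Φ x - Φ y‖ + ‖((u x - inner ℝ v x) - (u y - inner ℝ v y)) • w‖ := by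
      refine le_trans (le_of_eq ?_) (norm_sub_le _ _)
      rw [hsub, add_sub_cancel_right]
    have h3 : (1 - ε) * ‖x - y‖ ≤ ‖Φ x - Φ y‖ := by linarith
    calc ‖x - y‖ = κ * ((1 - ε) * ‖x - y‖) := by rw [← mul_assoc, hκε, one_mul]
      _ ≤ _ := by gcongr
  have hinj : InjOn Φ D := fun x hx y hy hxy => by
    have := hanti x hx y hy
    rw [hxy, sub_self, norm_zero, mul_zero] at this
    exact sub_eq_zero.1 (norm_le_zero_iff.1 this)
  have hder : ∀ x ∈ A, HasFDerivWithinAt Φ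
      (ContinuousLinearMap.id ℝ V + (fderiv ℝ u x - innerSL ℝ v).smulRight w) A x := fun x hx =>
    ((hasFDerivAt_id x).add (((hu x (hAD hx)).hasFDerivAt.sub
      (innerSL ℝ v).hasFDerivAt).smul_const w)).hasFDerivWithinAt
  -- The derivative is a rank-one perturbation of the identity, with determinant `1 + (fderiv ℝ u x
  -- - ⟨v, ·⟩) w`; the `1` cancels against `⟨v, w⟩`.
  have hdet : ∀ x, (ContinuousLinearMap.id ℝ V + (fderiv ℝ u x - innerSL ℝ v).smulRight w).det =
      fderiv ℝ u x w := fun x => by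
    have h1 : ((ContinuousLinearMap.id ℝ V + (fderiv ℝ u x - innerSL ℝ v).smulRight w :
        V →L[ℝ] V) : V →ₗ[ℝ] V) =
        LinearMap.transvection ((fderiv ℝ u x - innerSL ℝ v : V →L[ℝ] ℝ) : V →ₗ[ℝ] ℝ) w := by
      ext y
      simp [LinearMap.transvection]
    rw [ContinuousLinearMap.det, h1, LinearMap.transvection.det]
    simp [hvw]
  have himg : MeasurableSet (Φ '' A) :=
    measurable_image_of_fderivWithin hA hder (hinj.mono hAD)
  have hset : ∀ t, Φ '' (A ∩ u ⁻¹' {t}) = Φ '' A ∩ {y | inner ℝ v y = t} := fun t => by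
    ext y
    constructor
    · rintro ⟨x, ⟨h1, h2⟩, rfl⟩
      exact ⟨⟨x, h1, rfl⟩, (hΦv x).trans h2⟩
    · rintro ⟨⟨x, h1, rfl⟩, h2⟩
      exact ⟨x, ⟨h1, (hΦv x).symm.trans h2⟩, rfl⟩
  -- Slices of the straightened piece stand in for the level sets: they are measurable in `t`, and
  -- the bi-Lipschitz bound costs only `κ ^ k` either way.
  refine ⟨fun t => Measure.euclideanHausdorffMeasure k (Φ '' A ∩ {y | inner ℝ v y = t}),
    measurable_euclideanHausdorffMeasure_slice hk hv himg, fun t => ?_, fun t => ?_,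
    fun η hη => ?_⟩
  · beta_reduce
    rw [← hset]
    exact euclideanHausdorffMeasure_image_le (hlip.mono (inter_subset_left.trans hAD)) k
  · beta_reduce
    rw [← hset]
    have hS : A ∩ u ⁻¹' {t} ⊆ D := inter_subset_left.trans hAD
    have hinv : (Function.invFunOn Φ D) '' (Φ '' (A ∩ u ⁻¹' {t})) = A ∩ u ⁻¹' {t} :=
      hinj.invFunOn_image hS
    conv_lhs => rw [← hinv]
    refine euclideanHausdorffMeasure_image_le (LipschitzOnWith.of_dist_le_mul ?_) k
    rintro _ ⟨x, hx, rfl⟩ _ ⟨y, hy, rfl⟩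
    rw [hinj.leftInvOn_invFunOn (hS hx), hinj.leftInvOn_invFunOn (hS hy), dist_eq_norm,
      dist_eq_norm]
    exact hanti x (hS hx) y (hS hy)
  · rw [lintegral_euclideanHausdorffMeasure_slice hk hv himg hη,
      lintegral_image_eq_lintegral_abs_det_fderiv_mul volume hA hder (hinj.mono hAD)]
    simp_rw [hdet, hΦv]
    have hlow : ∀ x ∈ A, ‖v‖ * |fderiv ℝ u x w| ≤ ‖fderiv ℝ u x‖ := fun x hx => by
      have := (fderiv ℝ u x).le_opNorm w
      rw [hwn, Real.norm_eq_abs] at this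
      calc ‖v‖ * |fderiv ℝ u x w| ≤ ‖v‖ * (‖fderiv ℝ u x‖ * ‖v‖⁻¹) := by gcongr
        _ = _ := by field_simp
    have hup : ∀ x ∈ A, ‖fderiv ℝ u x‖ ≤ κ ^ 2 * (‖v‖ * |fderiv ℝ u x w|) := fun x hx => by
      have h1 := hu' x (hAD hx)
      have h2 : ‖fderiv ℝ u x‖ ≤ (1 + ε) * ‖v‖ := by
        have := norm_add_le (fderiv ℝ u x - innerSL ℝ v) (innerSL ℝ v)
        rw [sub_add_cancel, innerSL_apply_norm] at this
        linarith
      have h3 : 1 - ε ≤ |fderiv ℝ u x w| := by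
        have h4 := (fderiv ℝ u x - innerSL ℝ v).le_opNorm w
        have h5 : ‖fderiv ℝ u x - innerSL ℝ v‖ * ‖w‖ ≤ ε := by
          rw [hwn]
          calc _ ≤ ε * ‖v‖ * ‖v‖⁻¹ := by gcongr
            _ = ε := by field_simp
        rw [sub_apply, innerSL_apply_apply, hvw, Real.norm_eq_abs] at h4
        have := abs_le.1 (h4.trans h5)
        exact le_trans (by linarith) (le_abs_self _)
      calc ‖fderiv ℝ u x‖ ≤ (1 + ε) * ‖v‖ := h2
        _ ≤ κ * ‖v‖ := by gcongr
        _ = κ ^ 2 * (‖v‖ * (1 - ε)) := by linear_combination (-(κ : ℝ) * ‖v‖) * hκε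
        _ ≤ _ := by gcongr
    have he : ∀ x, ‖v‖ₑ * ENNReal.ofReal |fderiv ℝ u x w| =
        ENNReal.ofReal (‖v‖ * |fderiv ℝ u x w|) := fun x => by
      rw [ENNReal.ofReal_mul hv'.le, ofReal_norm]
    rw [← lintegral_const_mul' _ _ enorm_ne_top, ← lintegral_const_mul' _ _ (by finiteness)]
    constructor
    · refine setLIntegral_mono' hA fun x hx => ?_
      rw [← mul_assoc, he, mul_comm, ← ofReal_norm]
      gcongr
      exact hlow x hx
    · refine setLIntegral_mono' hA fun x hx => ?_
      rw [← mul_assoc, ← mul_assoc, mul_assoc _ ‖v‖ₑ, he, mul_comm, ← ofReal_norm]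
      gcongr
      refine (ENNReal.ofReal_le_ofReal (hup x hx)).trans_eq ?_
      rw [ENNReal.ofReal_mul (by positivity), ENNReal.ofReal_pow (by positivity),
        ENNReal.ofReal_coe_nnreal]

end Coarea

/-! ### The coarea formula -/

/-- Lindelöf followed by disjointification; it passes from estimates on small balls to countable
sums over disjoint pieces. -/
theorem exists_measurable_partition_of_nhds {X : Type*} [TopologicalSpace X]
    [SecondCountableTopology X] [MeasurableSpace X] [OpensMeasurableSpace X] {A : Set X}
    (hA : MeasurableSet A) (hne : A.Nonempty) (D : X → Set X)
    (hD : ∀ x ∈ A, IsOpen (D x) ∧ x ∈ D x) :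
    ∃ B : ℕ → Set X, (∀ n, MeasurableSet (B n)) ∧ Pairwise (Function.onFun Disjoint B) ∧
      ⋃ n, B n = A ∧ ∀ n, ∃ x ∈ A, B n ⊆ D x := by
  obtain ⟨T, hTA, hTc, hT⟩ := TopologicalSpace.countable_cover_nhdsWithin (s := A) (f := D)
    fun x hx => mem_nhdsWithin_of_mem_nhds ((hD x hx).1.mem_nhds (hD x hx).2)
  have hTne : T.Nonempty := by
    obtain ⟨x, hx⟩ := hne
    obtain ⟨y, hy, -⟩ := mem_iUnion₂.1 (hT hx)
    exact ⟨y, hy⟩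
  obtain ⟨f, rfl⟩ := hTc.exists_eq_range hTne
  have hf : ∀ n, f n ∈ A := fun n => hTA ⟨n, rfl⟩
  refine ⟨fun n => A ∩ disjointed (fun n => D (f n)) n, fun n => hA.inter
    (MeasurableSet.disjointed (fun n => (hD _ (hf n)).1.measurableSet) n), fun i j hij =>
    ((disjoint_disjointed _ hij).mono inter_subset_right inter_subset_right), ?_,
    fun n => ⟨f n, hf n, inter_subset_right.trans (disjointed_subset _ n)⟩⟩
  rw [← inter_iUnion, iUnion_disjointed, inter_eq_left]
  simpa using hT

theorem exists_ball_fderiv_close {V : Type*} [NormedAddCommGroup V] [NormedSpace ℝ V] {U : Set V} (hU : IsOpen U) {u : V → ℝ} (hu : ContDiffOn ℝ 1 u U)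
    {x : V} (hx : x ∈ U) {δ : ℝ} (hδ : 0 < δ) :
    ∃ r > 0, ball x r ⊆ U ∧ ∀ y ∈ ball x r, ‖fderiv ℝ u y - fderiv ℝ u x‖ ≤ δ := by
  have hc := (hu.continuousOn_fderiv_of_isOpen hU le_rfl).continuousAt (hU.mem_nhds hx)
  have h1 : ∀ᶠ y in 𝓝 x, ‖fderiv ℝ u y - fderiv ℝ u x‖ < δ := by
    simpa [dist_eq_norm] using Metric.tendsto_nhds.1 hc δ hδ
  obtain ⟨r, hr, h⟩ := Metric.eventually_nhds_iff_ball.1 (h1.and (hU.mem_nhds hx))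
  exact ⟨r, hr, fun y hy => (h y hy).2, fun y hy => (h y hy).1.le⟩

theorem tsum_euclideanHausdorffMeasure_level {V : Type*} [EMetricSpace V] [MeasurableSpace V]
    [BorelSpace V] {u : V → ℝ} (hum : Measurable u) {B : ℕ → Set V}
    (hB : ∀ n, MeasurableSet (B n)) (hBd : Pairwise (Function.onFun Disjoint B)) (t : ℝ) (k : ℕ) :
    Measure.euclideanHausdorffMeasure k ((⋃ n, B n) ∩ u ⁻¹' {t}) =
      ∑' n, Measure.euclideanHausdorffMeasure k (B n ∩ u ⁻¹' {t}) := by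
  rw [iUnion_inter]
  exact measure_iUnion (fun i j hij => (hBd hij).mono inter_subset_left inter_subset_left)
    fun n => (hB n).inter (hum (measurableSet_singleton t))

section Coarea

variable {V : Type*} [NormedAddCommGroup V] [InnerProductSpace ℝ V] [FiniteDimensional ℝ V]
  [MeasurableSpace V] [BorelSpace V] {k : ℕ}

/-- Around a regular point `u` is as close to a linear form as desired. Summing the slice comparison
over a fine partition gives both inequalities up to powers of `κ`, and then `κ` decreases to `1`. -/
theorem coarea_of_fderiv_ne_zero (hk : Module.finrank ℝ V = k + 1) {U : Set V} (hU : IsOpen U)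
    {u : V → ℝ} (hum : Measurable u) (hu : ContDiffOn ℝ 1 u U) {A : Set V} (hA : MeasurableSet A)
    (hAU : A ⊆ U) (hA0 : ∀ x ∈ A, fderiv ℝ u x ≠ 0) {η : ℝ → ℝ≥0∞} (hη : Measurable η) :
    ∫⁻ t, η t * Measure.euclideanHausdorffMeasure k (A ∩ u ⁻¹' {t}) =
      ∫⁻ x in A, η (u x) * ‖fderiv ℝ u x‖ₑ := by
  rcases A.eq_empty_or_nonempty with rfl | hne
  · simp
  have key : ∀ κ : ℝ≥0, 1 < κ →
      ∫⁻ t, η t * Measure.euclideanHausdorffMeasure k (A ∩ u ⁻¹' {t}) ≤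
        κ ^ k * ∫⁻ x in A, η (u x) * ‖fderiv ℝ u x‖ₑ ∧
      ∫⁻ x in A, η (u x) * ‖fderiv ℝ u x‖ₑ ≤
        κ ^ (k + 2) * ∫⁻ t, η t * Measure.euclideanHausdorffMeasure k (A ∩ u ⁻¹' {t}) := by
    intro κ hκ
    have hκ' : 0 < 1 - (κ : ℝ)⁻¹ := by
      rw [sub_pos]
      exact inv_lt_one_of_one_lt₀ (by exact_mod_cast hκ)
    have hball : ∀ x : V, ∃ r > 0, x ∈ A → ball x r ⊆ U ∧
        ∀ y ∈ ball x r, ‖fderiv ℝ u y - fderiv ℝ u x‖ ≤ (1 - (κ : ℝ)⁻¹) * ‖fderiv ℝ u x‖ := by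
      intro x
      by_cases hx : x ∈ A
      · obtain ⟨r, hr, h⟩ := exists_ball_fderiv_close hU hu (hAU hx)
          (mul_pos hκ' (norm_pos_iff.2 (hA0 x hx)))
        exact ⟨r, hr, fun _ => h⟩
      · exact ⟨1, one_pos, fun h => absurd h hx⟩
    choose r hr hball using hball
    obtain ⟨B, hBm, hBd, hBA, hB⟩ := exists_measurable_partition_of_nhds hA hne
      (fun x => ball x (r x)) (fun x _ => ⟨isOpen_ball, mem_ball_self (hr x)⟩)
    have hpiece : ∀ n, ∃ m : ℝ → ℝ≥0∞, Measurable m ∧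
        (∀ t, m t ≤ κ ^ k * Measure.euclideanHausdorffMeasure k (B n ∩ u ⁻¹' {t})) ∧
        (∀ t, Measure.euclideanHausdorffMeasure k (B n ∩ u ⁻¹' {t}) ≤ κ ^ k * m t) ∧
        ∀ η : ℝ → ℝ≥0∞, Measurable η →
          ∫⁻ t, η t * m t ≤ ∫⁻ x in B n, η (u x) * ‖fderiv ℝ u x‖ₑ ∧
          ∫⁻ x in B n, η (u x) * ‖fderiv ℝ u x‖ₑ ≤ κ ^ 2 * ∫⁻ t, η t * m t := by
      intro n
      obtain ⟨x, hx, hBx⟩ := hB n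
      obtain ⟨v, hv⟩ : ∃ v : V, innerSL ℝ v = fderiv ℝ u x :=
        ⟨(InnerProductSpace.toDual ℝ V).symm (fderiv ℝ u x), by ext y; simp⟩
      have hnv : ‖fderiv ℝ u x‖ = ‖v‖ := by rw [← hv, innerSL_apply_norm]
      refine exists_slice_comparison hk (v := v) ?_ hκ.le (convex_ball x (r x)) (hBm n) hBx
        (fun y hy => (hu.differentiableOn one_ne_zero).differentiableAt
          (hU.mem_nhds ((hball x hx).1 hy))) fun y hy => ?_
      · rw [← norm_ne_zero_iff, ← hnv, norm_ne_zero_iff]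
        exact hA0 x hx
      · rw [hv, ← hnv]
        exact (hball x hx).2 y hy
    choose m hmm hm1 hm2 hm3 using hpiece
    have hsumH : ∀ t, Measure.euclideanHausdorffMeasure k (A ∩ u ⁻¹' {t}) =
        ∑' n, Measure.euclideanHausdorffMeasure k (B n ∩ u ⁻¹' {t}) := fun t => by
      rw [← hBA, tsum_euclideanHausdorffMeasure_level hum hBm hBd]
    have hsumI : ∫⁻ x in A, η (u x) * ‖fderiv ℝ u x‖ₑ =
        ∑' n, ∫⁻ x in B n, η (u x) * ‖fderiv ℝ u x‖ₑ := by
      rw [← hBA, lintegral_iUnion hBm hBd]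
    -- Sum and integral are interchanged only for the measurable `m n`; the level-set measures enter
    -- through monotonicity alone.
    have hsumM : ∫⁻ t, η t * ∑' n, m n t = ∑' n, ∫⁻ t, η t * m n t := by
      simp_rw [← ENNReal.tsum_mul_left]
      exact lintegral_tsum fun n => (hη.mul (hmm n)).aemeasurable
    constructor
    · calc ∫⁻ t, η t * Measure.euclideanHausdorffMeasure k (A ∩ u ⁻¹' {t})
          ≤ ∫⁻ t, κ ^ k * (η t * ∑' n, m n t) := lintegral_mono fun t => by
            rw [mul_left_comm, ← ENNReal.tsum_mul_left, hsumH]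
            exact mul_le_mul_right (ENNReal.tsum_le_tsum fun n => hm2 n t) _
        _ = κ ^ k * ∑' n, ∫⁻ t, η t * m n t := by
            rw [lintegral_const_mul' _ _ (by finiteness), hsumM]
        _ ≤ _ := by
            rw [hsumI]
            exact mul_le_mul_right (ENNReal.tsum_le_tsum fun n => (hm3 n η hη).1) _
    · calc ∫⁻ x in A, η (u x) * ‖fderiv ℝ u x‖ₑ
          ≤ κ ^ 2 * ∫⁻ t, η t * ∑' n, m n t := by
            rw [hsumI, hsumM, ← ENNReal.tsum_mul_left]
            exact ENNReal.tsum_le_tsum fun n => (hm3 n η hη).2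
        _ ≤ κ ^ 2 * ∫⁻ t, κ ^ k *
            (η t * Measure.euclideanHausdorffMeasure k (A ∩ u ⁻¹' {t})) := by
            refine mul_le_mul_right (lintegral_mono fun t => ?_) _
            rw [mul_left_comm, hsumH t, ← ENNReal.tsum_mul_left (a := (κ : ℝ≥0∞) ^ k)]
            exact mul_le_mul_right (ENNReal.tsum_le_tsum fun n => hm1 n t) _
        _ = _ := by
            rw [lintegral_const_mul' _ _ (by finiteness), ← mul_assoc, ← pow_add, add_comm 2 k]
  have hlim : ∀ (j : ℕ) (I : ℝ≥0∞),
      Tendsto (fun κ : ℝ≥0 => (κ : ℝ≥0∞) ^ j * I) (𝓝[>] 1) (𝓝 I) := fun j I => by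
    have h1 : Tendsto (fun κ : ℝ≥0 => ((κ : ℝ≥0∞)) ^ j) (𝓝[>] 1) (𝓝 1) := by
      have : Continuous fun κ : ℝ≥0 => ((κ : ℝ≥0∞)) ^ j := by fun_prop
      simpa using (this.tendsto 1).mono_left nhdsWithin_le_nhds
    simpa using ENNReal.Tendsto.mul_const h1 (Or.inl one_ne_zero)
  refine le_antisymm (ge_of_tendsto (hlim k _) ?_) (ge_of_tendsto (hlim (k + 2) _) ?_)
  · filter_upwards [self_mem_nhdsWithin] with κ hκ using (key κ hκ).1
  · filter_upwards [self_mem_nhdsWithin] with κ hκ using (key κ hκ).2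

/-- Almost every level set meets the critical set in a null set. -/
theorem ae_euclideanHausdorffMeasure_critical_eq_zero (hk : Module.finrank ℝ V = k + 1) {U : Set V}
    (hU : IsOpen U) {u : V → ℝ} (hu : ContDiffOn ℝ 1 u U) {A : Set V}
    (hA : MeasurableSet A) (hAU : A ⊆ U) (hfin : volume A ≠ ∞)
    (hA0 : ∀ x ∈ A, fderiv ℝ u x = 0) :
    ∀ᵐ t, Measure.euclideanHausdorffMeasure k (A ∩ u ⁻¹' {t}) = 0 := by
  rcases A.eq_empty_or_nonempty with rfl | hne
  · simp
  have hfin' : μH[(k : ℝ) + 1] A ≠ ∞ := by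
    intro h
    apply hfin
    rw [← InnerProductSpace.euclideanHausdorffMeasure_eq_volume, hk,
      Measure.euclideanHausdorffMeasure_def, Measure.smul_apply, ENNReal.smul_def, smul_eq_mul]
    push_cast
    rw [h, ENNReal.mul_top]
    exact_mod_cast Measure.addHaarScalarFactor_volume_hausdorffMeasure_ne_zero (k + 1)
  -- Near a critical point `u` is `ε`-Lipschitz, so Eilenberg's inequality yields a factor `ε` on
  -- each piece. As `ε` tends to `0`, the infimum of these majorants has integral `0`.
  have key : ∀ ε : ℝ≥0, 0 < ε → ∃ m : ℝ → ℝ≥0∞, Measurable m ∧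
      (∀ t, μH[k] (A ∩ u ⁻¹' {t}) ≤ m t) ∧ ∫⁻ t, m t ≤ ε * μH[(k : ℝ) + 1] A := by
    intro ε hε
    have hball : ∀ x : V, ∃ r > 0, x ∈ A → ball x r ⊆ U ∧
        ∀ y ∈ ball x r, ‖fderiv ℝ u y - fderiv ℝ u x‖ ≤ ε := by
      intro x
      by_cases hx : x ∈ A
      · obtain ⟨r, hr, h⟩ := exists_ball_fderiv_close hU hu (hAU hx) (NNReal.coe_pos.2 hε)
        exact ⟨r, hr, fun _ => h⟩
      · exact ⟨1, one_pos, fun h => absurd h hx⟩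
    choose r hr hball using hball
    obtain ⟨B, hBm, hBd, hBA, hB⟩ := exists_measurable_partition_of_nhds hA hne
      (fun x => ball x (r x)) (fun x _ => ⟨isOpen_ball, mem_ball_self (hr x)⟩)
    have hpiece : ∀ n, ∃ m : ℝ → ℝ≥0∞, Measurable m ∧ (∀ t, μH[k] (B n ∩ u ⁻¹' {t}) ≤ m t) ∧
        ∫⁻ t, m t ≤ ε * μH[(k : ℝ) + 1] (B n) := by
      intro n
      obtain ⟨x, hx, hBx⟩ := hB n
      refine exists_measurable_hausdorffMeasure_inter_preimage_le (Nat.cast_nonneg k)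
        (LipschitzOnWith.mono (LipschitzOnWith.of_dist_le_mul fun y hy z hz => ?_) hBx) ?_
      · rw [dist_eq_norm, dist_eq_norm]
        refine (convex_ball x (r x)).norm_image_sub_le_of_norm_hasFDerivWithin_le
          (f' := fderiv ℝ u) (fun y hy => ?_) (fun y hy => ?_) hz hy
        · exact ((hu.differentiableOn one_ne_zero).differentiableAt
            (hU.mem_nhds ((hball x hx).1 hy))).hasFDerivAt.hasFDerivWithinAt
        · simpa [hA0 x hx] using (hball x hx).2 y hy
      · exact ((measure_mono ((subset_iUnion B n).trans hBA.subset)).trans_lt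
          (lt_top_iff_ne_top.2 hfin')).ne
    choose m hmm hm1 hm2 using hpiece
    refine ⟨fun t => ∑' n, m n t, Measurable.tsum hmm, fun t => ?_, ?_⟩
    · rw [← hBA, iUnion_inter]
      exact (measure_iUnion_le _).trans (ENNReal.tsum_le_tsum fun n => hm1 n t)
    · rw [lintegral_tsum fun n => (hmm n).aemeasurable, ← hBA, measure_iUnion hBd hBm,
        ← ENNReal.tsum_mul_left]
      exact ENNReal.tsum_le_tsum hm2
  have hpos : ∀ n : ℕ, 0 < ((n : ℝ≥0) + 1)⁻¹ := fun n => by positivity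
  choose m hmm hm1 hm2 using fun n : ℕ => key _ (hpos n)
  have hzero : ∫⁻ t, ⨅ n, m n t = 0 := by
    have hlim : Tendsto (fun n : ℕ => (((n : ℝ≥0) + 1)⁻¹ : ℝ≥0) * μH[(k : ℝ) + 1] A) atTop
        (𝓝 (((0 : ℝ≥0) : ℝ≥0∞) * μH[(k : ℝ) + 1] A)) := by
      refine ENNReal.Tendsto.mul_const (ENNReal.tendsto_coe.2 ?_) (Or.inr hfin')
      have := tendsto_one_div_add_atTop_nhds_zero_nat (𝕜 := ℝ)
      rw [← NNReal.tendsto_coe]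
      simpa using this
    rw [ENNReal.coe_zero, zero_mul] at hlim
    exact le_antisymm (ge_of_tendsto' hlim fun n =>
      (lintegral_mono fun t => iInf_le _ n).trans (hm2 n)) zero_le
  filter_upwards [(lintegral_eq_zero_iff (Measurable.iInf hmm)).1 hzero] with t ht
  rw [Measure.euclideanHausdorffMeasure_def, Measure.smul_apply]
  have : μH[k] (A ∩ u ⁻¹' {t}) = 0 := le_antisymm ((le_iInf fun n => hm1 n t).trans ht.le) zero_le
  rw [this, smul_zero]

/-- The coarea formula for a real-valued function of class `C¹`. -/
theorem lintegral_coarea (hk : Module.finrank ℝ V = k + 1) {U : Set V} (hU : IsOpen U)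
    {u : V → ℝ} (hum : Measurable u) (hu : ContDiffOn ℝ 1 u U) {A : Set V} (hA : MeasurableSet A)
    (hAU : A ⊆ U) (hfin : volume A ≠ ∞) {η : ℝ → ℝ≥0∞} (hη : Measurable η) :
    ∫⁻ t, η t * Measure.euclideanHausdorffMeasure k (A ∩ u ⁻¹' {t}) =
      ∫⁻ x in A, η (u x) * ‖fderiv ℝ u x‖ₑ := by
  have hC : MeasurableSet {x | fderiv ℝ u x = 0} :=
    (measurable_fderiv ℝ u) (measurableSet_singleton 0)
  have h1 := ae_euclideanHausdorffMeasure_critical_eq_zero (k := k) hk hU hu (hA.inter hC)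
    (inter_subset_left.trans hAU) (ne_top_of_le_ne_top hfin (measure_mono inter_subset_left))
    fun x hx => hx.2
  have h2 := coarea_of_fderiv_ne_zero (k := k) hk hU hum hu (hA.diff hC)
    (sdiff_subset.trans hAU) (fun x hx => hx.2) hη
  -- The critical set contributes to neither side: the integrand vanishes on it, and almost every
  -- level meets it in a null set.
  have h3 : ∫⁻ x in A, η (u x) * ‖fderiv ℝ u x‖ₑ =
      ∫⁻ x in A \ {x | fderiv ℝ u x = 0}, η (u x) * ‖fderiv ℝ u x‖ₑ := by
    rw [← lintegral_inter_add_sdiff _ A hC]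
    have : ∫⁻ x in A ∩ {x | fderiv ℝ u x = 0}, η (u x) * ‖fderiv ℝ u x‖ₑ = 0 := by
      rw [setLIntegral_congr_fun (g := fun _ => 0) (hA.inter hC)]
      · simp
      · rintro x ⟨-, hx : fderiv ℝ u x = 0⟩
        beta_reduce
        rw [← ofReal_norm, hx, norm_zero, ENNReal.ofReal_zero, mul_zero]
    rw [this, zero_add]
  rw [h3, ← h2]
  refine lintegral_congr_ae ?_
  filter_upwards [h1] with t ht
  congr 1
  refine le_antisymm ?_ (measure_mono (inter_subset_inter_left _ sdiff_subset))
  have hsub : A ∩ u ⁻¹' {t} ⊆ (A ∩ {x | fderiv ℝ u x = 0}) ∩ u ⁻¹' {t} ∪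
      (A \ {x | fderiv ℝ u x = 0}) ∩ u ⁻¹' {t} := by
    rw [← union_inter_distrib_right, inter_union_sdiff]
  refine (measure_mono hsub).trans ((measure_union_le _ _).trans ?_)
  rw [ht, zero_add]

end Coarea

/-! ### One- and two-dimensional Gaussian integrals -/

section Gaussian

theorem gaussianPDF_zero_one (x : ℝ) :
    gaussianPDF 0 1 x = ENNReal.ofReal ((√(2 * Real.pi))⁻¹ * Real.exp (-x ^ 2 / 2)) := by
  simp [gaussianPDF, gaussianPDFReal]

theorem gaussianPDF_mul_gaussianPDF_of_sq_add_sq {a b c d : ℝ} (h : a ^ 2 + b ^ 2 = c ^ 2 + d ^ 2) :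
    gaussianPDF 0 1 a * gaussianPDF 0 1 b = gaussianPDF 0 1 c * gaussianPDF 0 1 d := by
  have : Real.exp (-a ^ 2 / 2) * Real.exp (-b ^ 2 / 2) =
      Real.exp (-c ^ 2 / 2) * Real.exp (-d ^ 2 / 2) := by
    rw [← Real.exp_add, ← Real.exp_add]
    congr 1
    linarith
  simp_rw [gaussianPDF_zero_one]
  rw [← ENNReal.ofReal_mul (by positivity), ← ENNReal.ofReal_mul (by positivity),
    mul_mul_mul_comm, this, mul_mul_mul_comm]

theorem lintegral_gaussianReal_zero_one (f : ℝ → ℝ≥0∞) :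
    ∫⁻ t, f t ∂gaussianReal 0 1 = ∫⁻ t, gaussianPDF 0 1 t * f t := by
  rw [gaussianReal_of_var_ne_zero _ one_ne_zero,
    lintegral_withDensity_eq_lintegral_mul_non_measurable _ (measurable_gaussianPDF 0 1)
      (Eventually.of_forall fun _ => gaussianPDF_lt_top)]
  rfl

theorem lintegral_comp_affine {C : ℝ} (hC : C ≠ 0) (D : ℝ) {f : ℝ → ℝ≥0∞} (hf : Measurable f) :
    ∫⁻ s, f s * ‖C⁻¹‖ₑ = ∫⁻ w, f (C * w + D) := by
  have h1 : ENNReal.ofReal |C| * ‖C⁻¹‖ₑ = 1 := by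
    rw [← Real.enorm_eq_ofReal_abs, ← enorm_mul, mul_inv_cancel₀ hC, enorm_one]
  rw [lintegral_mul_const' _ _ enorm_ne_top]
  conv_lhs => rw [← Real.smul_map_volume_mul_left hC]
  rw [lintegral_smul_measure, lintegral_map hf (by fun_prop), smul_eq_mul, mul_right_comm, h1,
    one_mul, ← lintegral_add_right_eq_self (fun w => f (C * w)) (D / C)]
  refine lintegral_congr fun w => ?_
  congr 1
  field_simp

/-- The integral of a Gaussian density along the line `{(t, s) | t C - s S + B = 0}`. -/
theorem lintegral_gaussian_line {C S B : ℝ} (hC : C ≠ 0) (hCS : C ^ 2 + S ^ 2 = 1)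
    {Ψ : ℝ → ℝ≥0∞} (hΨ : Measurable Ψ) :
    ∫⁻ s, gaussianPDF 0 1 ((s * S - B) / C) * Ψ ((s - B * S) / C) * ‖C⁻¹‖ₑ ∂gaussianReal 0 1 =
      gaussianPDF 0 1 B * ∫⁻ w, Ψ w ∂gaussianReal 0 1 := by
  simp_rw [lintegral_gaussianReal_zero_one, ← mul_assoc]
  have hm := measurable_gaussianPDF 0 1
  -- Substitute `s = C w + B S`, hence `t = S w - B C`: up to signs `(w, B)` is a rotation of `(t,
  -- s)`, so `t² + s² = w² + B²` and the product of the densities factors.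
  rw [lintegral_comp_affine hC (B * S) (f := fun s => gaussianPDF 0 1 s *
    gaussianPDF 0 1 ((s * S - B) / C) * Ψ ((s - B * S) / C)) (by fun_prop),
    ← lintegral_const_mul' _ _ gaussianPDF_ne_top]
  refine lintegral_congr fun w => ?_
  have e1 : (C * w + B * S - B * S) / C = w := by field_simp; ring
  have e2 : ((C * w + B * S) * S - B) / C = S * w - B * C := by
    rw [div_eq_iff hC]
    linear_combination (B) * hCS
  rw [e1, e2, ← mul_assoc]
  congr 1
  refine gaussianPDF_mul_gaussianPDF_of_sq_add_sq ?_
  linear_combination (w ^ 2 + B ^ 2) * hCS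

/-- Completing the square in `s` leaves the density of a Gaussian of mean `-a / (v + 1)` and
variance `v / (v + 1)`, of total mass `1`. -/
theorem lintegral_gaussianPDF_add {v : ℝ≥0} (hv : v ≠ 0) (a : ℝ) :
    ∫⁻ s, gaussianPDF 0 v (a + s) ∂gaussianReal 0 1 = gaussianPDF 0 (v + 1) a := by
  have hv0 : (0 : ℝ) < v := by positivity
  have hv1 : v / (v + 1) ≠ 0 := by positivity
  have h : ∀ s, gaussianPDF 0 1 s * gaussianPDF 0 v (a + s) =
      gaussianPDF 0 (v + 1) a * gaussianPDF (-(a / (v + 1))) (v / (v + 1)) s := by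
    intro s
    simp only [gaussianPDF]
    rw [← ENNReal.ofReal_mul (gaussianPDFReal_nonneg _ _ _),
      ← ENNReal.ofReal_mul (gaussianPDFReal_nonneg _ _ _)]
    congr 1
    simp only [gaussianPDFReal]
    rw [mul_mul_mul_comm, ← Real.exp_add, mul_mul_mul_comm, ← Real.exp_add, ← mul_inv, ← mul_inv,
      ← Real.sqrt_mul (by positivity), ← Real.sqrt_mul (by positivity)]
    push_cast
    congr 2
    · congr 1
      field_simp
    · field_simp
      ring
  rw [lintegral_gaussianReal_zero_one]
  simp_rw [h]
  rw [lintegral_const_mul' _ _ gaussianPDF_ne_top, lintegral_gaussianPDF_eq_one _ hv1, mul_one]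

theorem lintegral_pi_gaussianPDF_add_sum (m : ℕ) : ∀ {v : ℝ≥0} (_ : v ≠ 0) (a : ℝ),
    ∫⁻ b : Fin m → ℝ, gaussianPDF 0 v (a + ∑ i, b i) ∂Measure.pi (fun _ => gaussianReal 0 1) =
      gaussianPDF 0 (v + m) a := by
  induction m with
  | zero => intro v hv a; simp
  | succ m ih =>
    intro v hv a
    have hmp := (measurePreserving_piFinSuccAbove (fun _ : Fin (m + 1) => gaussianReal 0 1) 0).symm
    rw [← hmp.lintegral_comp_emb (MeasurableEquiv.measurableEmbedding _)]
    have hm := measurable_gaussianPDF 0 v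
    rw [lintegral_prod_symm _ (Measurable.aemeasurable (by
      refine hm.comp (measurable_const.add (Finset.measurable_sum _ fun i _ => ?_))
      exact (measurable_pi_apply i).comp (MeasurableEquiv.measurable _)))]
    simp only [MeasurableEquiv.piFinSuccAbove_symm_apply, Fin.insertNthEquiv_apply,
      Fin.sum_univ_succ, Fin.insertNth_zero', Fin.cons_zero, Fin.cons_succ]
    have : ∀ (y : Fin m → ℝ), ∫⁻ s, gaussianPDF 0 v (a + (s + ∑ i, y i)) ∂gaussianReal 0 1 =
        gaussianPDF 0 (v + 1) (a + ∑ i, y i) := fun y => by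
      rw [← lintegral_gaussianPDF_add hv]
      refine lintegral_congr fun s => ?_
      congr 1; ring
    simp_rw [this]
    rw [ih (by positivity)]
    congr 1
    push_cast
    ring

/-- The planar standard Gaussian measure is invariant under rotations. -/
theorem measurePreserving_rotation (θ : ℝ) :
    MeasurePreserving (fun p : ℝ × ℝ =>
      (p.1 * Real.cos θ - p.2 * Real.sin θ, p.1 * Real.sin θ + p.2 * Real.cos θ))
      ((gaussianReal 0 1).prod (gaussianReal 0 1)) ((gaussianReal 0 1).prod (gaussianReal 0 1)) := by
  -- In `ℂ` the rotation is a linear isometry, under which `stdGaussian` is invariant.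
  have h1 : MeasurePreserving Complex.measurableEquivRealProd.symm
      ((gaussianReal 0 1).prod (gaussianReal 0 1)) (stdGaussian ℂ) := by
    refine ⟨MeasurableEquiv.measurable _, ?_⟩
    rw [stdGaussian_eq_map_pi_orthonormalBasis Complex.orthonormalBasisOneI,
      ← (measurePreserving_finTwoArrow (gaussianReal 0 1)).map_eq,
      Measure.map_map (MeasurableEquiv.measurable _) (MeasurableEquiv.measurable _)]
    congr 1
    ext x
    simp [Fin.sum_univ_two, Complex.ext_iff]
  have h2 : MeasurePreserving (rotation (Circle.exp θ)) (stdGaussian ℂ) (stdGaussian ℂ) :=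
    ⟨(rotation (Circle.exp θ)).continuous.measurable, stdGaussian_map _⟩
  have h3 := (h1.symm.comp h2).comp h1
  convert h3 using 1
  ext p
  · simp [Circle.coe_exp, Complex.exp_ofReal_mul_I_re, Complex.exp_ofReal_mul_I_im]
    ring
  · simp [Circle.coe_exp, Complex.exp_ofReal_mul_I_re, Complex.exp_ofReal_mul_I_im]
    ring

end Gaussian

/-! ### Kac–Rice for one random wave plus a fixed function -/

theorem contDiff_phase {V : Type*} [NormedAddCommGroup V] [InnerProductSpace ℝ V]
    (α : ℝ) (l : V) : ContDiff ℝ 1 fun x => α + inner ℝ l x :=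
  contDiff_const.add (contDiff_const.inner ℝ contDiff_id)

theorem fderiv_cos_phase {V : Type*} [NormedAddCommGroup V] [InnerProductSpace ℝ V]
    (α : ℝ) (l x : V) : fderiv ℝ (fun y => Real.cos (α + inner ℝ l y)) x =
    -(Real.sin (α + inner ℝ l x)) • innerSL ℝ l := by
  have : HasFDerivAt (fun y => α + inner ℝ l y) (innerSL ℝ l) x :=
    (innerSL ℝ l).hasFDerivAt.const_add α
  exact this.cos.fderiv

theorem fderiv_sin_phase {V : Type*} [NormedAddCommGroup V] [InnerProductSpace ℝ V]
    (α : ℝ) (l x : V) : fderiv ℝ (fun y => Real.sin (α + inner ℝ l y)) x =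
    Real.cos (α + inner ℝ l x) • innerSL ℝ l := by
  have : HasFDerivAt (fun y => α + inner ℝ l y) (innerSL ℝ l) x :=
    (innerSL ℝ l).hasFDerivAt.const_add α
  exact this.sin.fderiv

section KacRice

variable {V : Type*} [NormedAddCommGroup V] [InnerProductSpace ℝ V] [FiniteDimensional ℝ V]
  [MeasurableSpace V] [BorelSpace V] {k : ℕ}

/-- Where `h ≠ 0` the equation reads `t = -g / h`, so the zero sets are level sets of one function,
and the coarea formula applies with the Gaussian density as weight. -/
theorem lintegral_zeros_add_mul (hk : Module.finrank ℝ V = k + 1) {g h : V → ℝ}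
    (hg : ContDiff ℝ 1 g) (hh : ContDiff ℝ 1 h) {A : Set V} (hA : MeasurableSet A)
    (hfin : volume A ≠ ∞) (hA0 : ∀ x ∈ A, h x ≠ 0) :
    ∫⁻ t, Measure.euclideanHausdorffMeasure k (A ∩ {x | t * h x + g x = 0}) ∂gaussianReal 0 1 =
      ∫⁻ x in A, gaussianPDF 0 1 (-g x / h x) *
        ‖fderiv ℝ g x + (-g x / h x) • fderiv ℝ h x‖ₑ * ‖(h x)⁻¹‖ₑ := by
  have hU : IsOpen {x | h x ≠ 0} := isOpen_ne_fun hh.continuous continuous_const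
  have hu : ContDiffOn ℝ 1 (fun x => -g x / h x) {x | h x ≠ 0} :=
    hg.neg.contDiffOn.div hh.contDiffOn fun x hx => hx
  have hum : Measurable fun x => -g x / h x :=
    hg.continuous.measurable.neg.div hh.continuous.measurable
  have hset : ∀ t, A ∩ {x | t * h x + g x = 0} = A ∩ (fun x => -g x / h x) ⁻¹' {t} := by
    intro t
    ext x
    simp only [mem_inter_iff, mem_ofPred_eq, mem_preimage, mem_singleton_iff]
    refine and_congr_right fun hx => ?_
    rw [div_eq_iff (hA0 x hx)]
    constructor <;> intro h <;> linarith
  simp_rw [hset]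
  rw [lintegral_gaussianReal_zero_one, lintegral_coarea hk hU hum hu hA hA0 hfin
    (measurable_gaussianPDF 0 1)]
  refine setLIntegral_congr_fun hA fun x hx => ?_
  have hx0 := hA0 x hx
  have hd : HasFDerivAt (fun x => -g x / h x)
      (-(h x)⁻¹ • (fderiv ℝ g x + (-g x / h x) • fderiv ℝ h x)) x := by
    have h1 := (hg.differentiable one_ne_zero x).hasFDerivAt
    have h2 := (hh.differentiable one_ne_zero x).hasFDerivAt
    refine (h1.fun_neg.mul ((hasDerivAt_inv hx0).comp_hasFDerivAt x h2)).congr_fderiv ?_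
    ext y
    simp
    field_simp
    ring
  rw [hd.fderiv, enorm_smul, enorm_neg, mul_assoc, mul_comm ‖(h x)⁻¹‖ₑ]

/-- After the coarea formula in `t`, the integral over `s` at fixed `x` runs along a line in the
`(t, s)`-plane, and `lintegral_gaussian_line` evaluates it. The phase `α` lets one statement serve
both the cosine and the sine. -/
theorem lintegral_lintegral_zeros_wave_add (hk : Module.finrank ℝ V = k + 1) {B : V → ℝ}
    (hB : ContDiff ℝ 1 B) {G : V → V} (hGc : Continuous G)
    (hG : ∀ x, fderiv ℝ B x = -innerSL ℝ (G x)) (α : ℝ) (l : V) {A : Set V} (hA : MeasurableSet A)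
    (hfin : volume A ≠ ∞) (hA0 : ∀ x ∈ A, Real.cos (α + inner ℝ l x) ≠ 0) :
    ∫⁻ s, ∫⁻ t, Measure.euclideanHausdorffMeasure k (A ∩ {x | t * Real.cos (α + inner ℝ l x) -
        s * Real.sin (α + inner ℝ l x) + B x = 0}) ∂gaussianReal 0 1 ∂gaussianReal 0 1 =
      ∫⁻ x in A, gaussianPDF 0 1 (B x) * ∫⁻ w, ‖G x + w • l‖ₑ ∂gaussianReal 0 1 := by
  have hcos : ContDiff ℝ 1 fun x => Real.cos (α + inner ℝ l x) := (contDiff_phase α l).cos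
  have hsin : ContDiff ℝ 1 fun x => Real.sin (α + inner ℝ l x) := (contDiff_phase α l).sin
  have h1 : ∀ s, ∫⁻ t, Measure.euclideanHausdorffMeasure k (A ∩ {x |
      t * Real.cos (α + inner ℝ l x) - s * Real.sin (α + inner ℝ l x) + B x = 0})
        ∂gaussianReal 0 1 =
      ∫⁻ x in A, gaussianPDF 0 1 ((s * Real.sin (α + inner ℝ l x) - B x) /
          Real.cos (α + inner ℝ l x)) *
        ‖G x + ((s - B x * Real.sin (α + inner ℝ l x)) / Real.cos (α + inner ℝ l x)) • l‖ₑ *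
        ‖(Real.cos (α + inner ℝ l x))⁻¹‖ₑ := by
    intro s
    have h2 : ContDiff ℝ 1 fun x => B x - s * Real.sin (α + inner ℝ l x) :=
      hB.sub (contDiff_const.mul hsin)
    have h3 := lintegral_zeros_add_mul hk h2 hcos hA hfin hA0
    convert h3 using 1
    · refine lintegral_congr fun t => ?_
      congr 3
      ext x
      constructor <;> intro (h : _ = (0 : ℝ)) <;> linarith
    · refine setLIntegral_congr_fun hA fun x hx => ?_
      have hx0 := hA0 x hx
      have h4 : fderiv ℝ (fun x => B x - s * Real.sin (α + inner ℝ l x)) x =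
          -innerSL ℝ (G x) - s • Real.cos (α + inner ℝ l x) • innerSL ℝ l := by
        rw [fderiv_fun_sub (hB.differentiable one_ne_zero x)
          ((hsin.differentiable one_ne_zero x).const_mul s),
          fderiv_const_mul (hsin.differentiable one_ne_zero x), fderiv_sin_phase, hG]
      rw [h4, fderiv_cos_phase, neg_sub]
      congr 2
      -- On the zero set the gradient is, up to sign, `G + w l` with `w` the coordinate along that
      -- line; this uses `sin² + cos² = 1`.
      have h5 : -innerSL ℝ (G x) - s • Real.cos (α + inner ℝ l x) • innerSL ℝ l +
          ((s * Real.sin (α + inner ℝ l x) - B x) / Real.cos (α + inner ℝ l x)) •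
            -(Real.sin (α + inner ℝ l x)) • innerSL ℝ l =
          -innerSL ℝ (G x + ((s - B x * Real.sin (α + inner ℝ l x)) /
            Real.cos (α + inner ℝ l x)) • l) := by
        ext y
        simp
        field_simp
        linear_combination (-s * inner ℝ l y) * Real.sin_sq_add_cos_sq (α + inner ℝ l x)
      rw [h5, enorm_neg, ← ofReal_norm, ← ofReal_norm, innerSL_apply_norm]
  simp_rw [h1]
  have hpdf := measurable_gaussianPDF 0 1
  have hBm := hB.continuous.measurable
  have hGm := hGc.measurable
  have hcm := hcos.continuous.measurable
  have hsm := hsin.continuous.measurable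
  rw [lintegral_lintegral_swap (Measurable.aemeasurable (by unfold Function.uncurry; fun_prop))]
  refine setLIntegral_congr_fun hA fun x hx => ?_
  exact lintegral_gaussian_line (hA0 x hx) (by rw [add_comm]; exact Real.sin_sq_add_cos_sq _)
    (Ψ := fun w => ‖G x + w • l‖ₑ) (by fun_prop)

theorem lintegral_gaussianReal_comp_neg {f : ℝ → ℝ≥0∞} (hf : Measurable f) :
    ∫⁻ w, f (-w) ∂gaussianReal 0 1 = ∫⁻ w, f w ∂gaussianReal 0 1 := by
  conv_rhs => rw [← neg_zero (G := ℝ), ← gaussianReal_map_neg]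
  rw [lintegral_map hf measurable_neg]

/-- The Kac–Rice formula for the sum of a random wave and a fixed function. -/
theorem lintegral_prod_zeros_wave_add (hk : Module.finrank ℝ V = k + 1) {B : V → ℝ}
    (hB : ContDiff ℝ 1 B) {G : V → V} (hGc : Continuous G)
    (hG : ∀ x, fderiv ℝ B x = -innerSL ℝ (G x)) (l : V) {K : ℕ → Set V} (hKm : Monotone K)
    (hK : ∀ n, IsCompact (K n)) (hfin : volume (⋃ n, K n) ≠ ∞) :
    ∫⁻ p : ℝ × ℝ, Measure.euclideanHausdorffMeasure k ((⋃ n, K n) ∩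
        {x | p.1 * Real.cos (inner ℝ l x) - p.2 * Real.sin (inner ℝ l x) + B x = 0})
        ∂(gaussianReal 0 1).prod (gaussianReal 0 1) =
      ∫⁻ x in ⋃ n, K n, gaussianPDF 0 1 (B x) * ∫⁻ w, ‖G x + w • l‖ₑ ∂gaussianReal 0 1 := by
  have hcont : Continuous fun q : (ℝ × ℝ) × V =>
      q.1.1 * Real.cos (inner ℝ l q.2) - q.1.2 * Real.sin (inner ℝ l q.2) + B q.2 := by
    have := hB.continuous
    fun_prop
  have hc : Continuous fun x => Real.cos (inner ℝ l x) ^ 2 := by fun_prop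
  -- The cosine is bounded away from `0` on the first part, the sine on the second. The strict
  -- inequality of the second is exhausted by closed conditions with margin `1 / (n + 1)`.
  let K₁ : ℕ → Set V := fun n => K n ∩ {x | 1 / 2 ≤ Real.cos (inner ℝ l x) ^ 2}
  let K₂ : ℕ → Set V := fun n => K n ∩
    {x | Real.cos (inner ℝ l x) ^ 2 ≤ 1 / 2 - 1 / ((n : ℝ) + 1)}
  have hK₁ : ∀ n, IsCompact (K₁ n) := fun n =>
    (hK n).inter_right (isClosed_le continuous_const hc)
  have hK₂ : ∀ n, IsCompact (K₂ n) := fun n =>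
    (hK n).inter_right (isClosed_le hc continuous_const)
  have hKm₁ : Monotone K₁ := fun i j hij => inter_subset_inter_left _ (hKm hij)
  have hKm₂ : Monotone K₂ := fun i j hij => inter_subset_inter (hKm hij) fun x hx => by
    refine le_trans (mem_ofPred_eq ▸ hx) ?_
    have : (i : ℝ) ≤ j := by exact_mod_cast hij
    gcongr
  have hU₁ : ⋃ n, K₁ n = (⋃ n, K n) ∩ {x | 1 / 2 ≤ Real.cos (inner ℝ l x) ^ 2} :=
    (iUnion_inter _ _).symm
  have hU₂ : ⋃ n, K₂ n = (⋃ n, K n) \ {x | 1 / 2 ≤ Real.cos (inner ℝ l x) ^ 2} := by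
    ext x
    simp only [K₂, mem_iUnion, mem_inter_iff, mem_ofPred_eq, Set.mem_sdiff, not_le]
    constructor
    · rintro ⟨n, h1, h2⟩
      refine ⟨⟨n, h1⟩, h2.trans_lt ?_⟩
      have : 0 < 1 / ((n : ℝ) + 1) := by positivity
      linarith
    · rintro ⟨⟨n, h1⟩, h2⟩
      obtain ⟨j, hj⟩ := exists_nat_one_div_lt (sub_pos.2 h2)
      refine ⟨max n j, hKm (le_max_left _ _) h1, ?_⟩
      have : 1 / (((max n j : ℕ) : ℝ) + 1) ≤ 1 / ((j : ℝ) + 1) := by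
        have : (j : ℝ) ≤ (max n j : ℕ) := by exact_mod_cast le_max_right n j
        gcongr
      linarith
  have hm₁ := measurable_euclideanHausdorffMeasure_zeros k hKm₁ hK₁ (Θ := ℝ × ℝ)
    (F := fun p x => p.1 * Real.cos (inner ℝ l x) - p.2 * Real.sin (inner ℝ l x) + B x) hcont
  have hm₂ := measurable_euclideanHausdorffMeasure_zeros k hKm₂ hK₂ (Θ := ℝ × ℝ)
    (F := fun p x => p.1 * Real.cos (inner ℝ l x) - p.2 * Real.sin (inner ℝ l x) + B x) hcont
  have hme₁ : MeasurableSet (⋃ n, K₁ n) := MeasurableSet.iUnion fun n => (hK₁ n).measurableSet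
  have hme₂ : MeasurableSet (⋃ n, K₂ n) := MeasurableSet.iUnion fun n => (hK₂ n).measurableSet
  have hme : MeasurableSet {x | 1 / 2 ≤ Real.cos (inner ℝ l x) ^ 2} :=
    (isClosed_le continuous_const hc).measurableSet
  have hsplit : ∀ S : Set V, Measure.euclideanHausdorffMeasure k ((⋃ n, K n) ∩ S) =
      Measure.euclideanHausdorffMeasure k ((⋃ n, K₁ n) ∩ S) +
      Measure.euclideanHausdorffMeasure k ((⋃ n, K₂ n) ∩ S) := fun S => by
    rw [← measure_inter_add_sdiff _ hme, hU₁, hU₂, inter_right_comm, inter_sdiff_right_comm]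
  have e₁ := lintegral_lintegral_zeros_wave_add hk hB hGc hG 0 l hme₁
    (ne_top_of_le_ne_top hfin (measure_mono (hU₁ ▸ inter_subset_left))) fun x hx => by
      rw [hU₁] at hx
      have : 1 / 2 ≤ Real.cos (inner ℝ l x) ^ 2 := hx.2
      intro h
      rw [zero_add] at h
      rw [h] at this
      norm_num at this
  -- Phase `-π/2` and frequency `-l` exchange cosine and sine up to sign, so that `c` takes the role
  -- of `b`.
  have hcosφ : ∀ x, Real.cos (-(Real.pi / 2) + inner ℝ (-l) x) = -Real.sin (inner ℝ l x) :=
    fun x => by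
      rw [inner_neg_left, ← neg_add, Real.cos_neg, add_comm, Real.cos_add_pi_div_two]
  have hsinφ : ∀ x, Real.sin (-(Real.pi / 2) + inner ℝ (-l) x) = -Real.cos (inner ℝ l x) :=
    fun x => by
      rw [inner_neg_left, ← neg_add, Real.sin_neg, add_comm, Real.sin_add_pi_div_two]
  have e₂ := lintegral_lintegral_zeros_wave_add hk hB hGc hG (-(Real.pi / 2)) (-l) hme₂
    (ne_top_of_le_ne_top hfin (measure_mono (hU₂ ▸ sdiff_subset))) fun x hx => by
      rw [hU₂] at hx
      have h1 : Real.cos (inner ℝ l x) ^ 2 < 1 / 2 := not_le.1 hx.2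
      intro h
      rw [hcosφ] at h
      have h2 := Real.sin_sq_add_cos_sq (inner ℝ l x)
      rw [neg_eq_zero.1 h] at h2
      linarith
  simp_rw [hsplit]
  -- The inner integral is over `b` on the first part and over `c` on the second.
  rw [lintegral_add_left hm₁, lintegral_prod_symm _ hm₁.aemeasurable,
    lintegral_prod _ hm₂.aemeasurable, ← lintegral_inter_add_sdiff _ (⋃ n, K n) hme, ← hU₁, ← hU₂]
  congr 1
  · simpa only [zero_add] using e₁
  · simp only [hcosφ, hsinφ] at e₂
    have h1 : ∀ x, ∫⁻ w, ‖G x + w • -l‖ₑ ∂gaussianReal 0 1 =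
        ∫⁻ w, ‖G x + w • l‖ₑ ∂gaussianReal 0 1 := fun x => by
      rw [← lintegral_gaussianReal_comp_neg (f := fun w => ‖G x + w • l‖ₑ) (by fun_prop)]
      simp
    simp_rw [h1] at e₂
    rw [← e₂]
    refine lintegral_congr fun b => lintegral_congr fun c => ?_
    congr 3
    ext x
    simp only
    rw [show b * Real.cos (inner ℝ l x) - c * Real.sin (inner ℝ l x) =
      c * -Real.sin (inner ℝ l x) - b * -Real.cos (inner ℝ l x) by ring]

end KacRice

/-! ### Random superpositions of plane waves -/

section Wave

variable {V : Type*} [NormedAddCommGroup V] [InnerProductSpace ℝ V] {ι : Type*} [Fintype ι]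

/-- The superposition `∑ (b_i cos ⟪l_i, x⟫ - c_i sin ⟪l_i, x⟫)` of plane waves, `z_i = (b_i, c_i)`. -/
noncomputable def wave (l : ι → V) (z : ι → ℝ × ℝ) (x : V) : ℝ :=
  ∑ i, ((z i).1 * Real.cos (inner ℝ (l i) x) - (z i).2 * Real.sin (inner ℝ (l i) x))

/-- Minus the gradient of `wave l z`. -/
noncomputable def waveGradient (l : ι → V) (z : ι → ℝ × ℝ) (x : V) : V :=
  ∑ i, ((z i).1 * Real.sin (inner ℝ (l i) x) + (z i).2 * Real.cos (inner ℝ (l i) x)) • l i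

theorem continuous_wave (l : ι → V) :
    Continuous fun q : (ι → ℝ × ℝ) × V => wave l q.1 q.2 := by
  unfold wave
  fun_prop

theorem continuous_waveGradient (l : ι → V) :
    Continuous fun q : (ι → ℝ × ℝ) × V => waveGradient l q.1 q.2 := by
  unfold waveGradient
  fun_prop

theorem contDiff_wave (l : ι → V) (z : ι → ℝ × ℝ) : ContDiff ℝ 1 (wave l z) := by
  refine ContDiff.sum fun i _ => ?_
  have h : ContDiff ℝ 1 fun x => inner ℝ (l i) x := contDiff_const.inner ℝ contDiff_id
  exact (contDiff_const.mul h.cos).sub (contDiff_const.mul h.sin)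

theorem fderiv_wave (l : ι → V) (z : ι → ℝ × ℝ) (x : V) :
    fderiv ℝ (wave l z) x = -innerSL ℝ (waveGradient l z x) := by
  have h : HasFDerivAt (wave l z) (∑ i, ((z i).1 • -Real.sin (inner ℝ (l i) x) • innerSL ℝ (l i) -
      (z i).2 • Real.cos (inner ℝ (l i) x) • innerSL ℝ (l i))) x := by
    refine HasFDerivAt.fun_sum fun i _ => ?_
    have h : HasFDerivAt (fun y => inner ℝ (l i) y) (innerSL ℝ (l i)) x :=
      (innerSL ℝ (l i)).hasFDerivAt
    exact (h.cos.const_mul _).sub (h.sin.const_mul _)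
  rw [h.fderiv]
  ext y
  simp only [waveGradient, map_sum, FunLike.coe_sum, Finset.sum_apply, sub_apply, smul_apply,
    neg_apply, innerSL_apply_apply, smul_eq_mul, inner_smul_left, ← Finset.sum_neg_distrib]
  refine Finset.sum_congr rfl fun i _ => ?_
  simp
  ring

theorem wave_cons {m : ℕ} (l : Fin (m + 1) → V) (p : ℝ × ℝ) (z : Fin m → ℝ × ℝ) (x : V) :
    wave l (Fin.cons p z) x = p.1 * Real.cos (inner ℝ (l 0) x) - p.2 * Real.sin (inner ℝ (l 0) x) +
      wave (Fin.tail l) z x := by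
  simp [wave, Fin.sum_univ_succ, Fin.tail]
  ring

theorem gaussianPDF_zero (v : ℝ≥0) :
    gaussianPDF 0 v 0 = ENNReal.ofReal (√(2 * Real.pi * v))⁻¹ := by
  simp [gaussianPDF, gaussianPDFReal]

/-- Rotating each pair by the angle `⟨l_i, x⟩` separates value and gradient into `∑ b_i` and `∑ c_i
l_i`, which are independent and free of `x`. The density of the frequency `l 0` smoothed by `m`
further normals has variance `m + 1`; the variable `w` is the missing coefficient of `l 0`. -/
theorem lintegral_gaussianPDF_wave_mul {m : ℕ} [MeasurableSpace V] [BorelSpace V]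
    [SecondCountableTopology V] (l : Fin (m + 1) → V) (x : V) :
    ∫⁻ z, gaussianPDF 0 1 (wave (Fin.tail l) z x) *
        ∫⁻ w, ‖waveGradient (Fin.tail l) z x + w • l 0‖ₑ ∂gaussianReal 0 1
        ∂Measure.pi (fun _ : Fin m => (gaussianReal 0 1).prod (gaussianReal 0 1)) =
      ENNReal.ofReal (√(2 * Real.pi * (m + 1)))⁻¹ *
        ∫⁻ c, ‖∑ i, c i • l i‖ₑ ∂Measure.pi (fun _ : Fin (m + 1) => gaussianReal 0 1) := by
  have hpdf := measurable_gaussianPDF 0 1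
  let Ψ : (Fin m → ℝ) → ℝ≥0∞ := fun c =>
    ∫⁻ w, ‖∑ i, c i • Fin.tail l i + w • l 0‖ₑ ∂gaussianReal 0 1
  have hΨ : Measurable Ψ := by
    refine Measurable.lintegral_prod_right' (f := fun q : (Fin m → ℝ) × ℝ =>
      ‖∑ i, q.1 i • Fin.tail l i + q.2 • l 0‖ₑ) ?_
    fun_prop
  have hrot := measurePreserving_pi
    (fun _ : Fin m => (gaussianReal 0 1).prod (gaussianReal 0 1)) _
    fun i => measurePreserving_rotation (inner ℝ (Fin.tail l i) x)
  have harr := measurePreserving_arrowProdEquivProdArrow ℝ ℝ (Fin m)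
    (fun _ => gaussianReal 0 1) (fun _ => gaussianReal 0 1)
  have hmeas : Measurable fun z : Fin m → ℝ × ℝ =>
      gaussianPDF 0 1 (∑ i, (z i).1) * Ψ fun i => (z i).2 :=
    (hpdf.comp (by fun_prop)).mul (hΨ.comp (by fun_prop))
  have e1 := hrot.lintegral_comp hmeas
  have hmeas' : Measurable fun q : (Fin m → ℝ) × (Fin m → ℝ) =>
      gaussianPDF 0 1 (∑ i, q.1 i) * Ψ q.2 :=
    (hpdf.comp (by fun_prop)).mul (hΨ.comp (by fun_prop))
  have e2 := harr.lintegral_comp hmeas'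
  have e3 : ∫⁻ b : Fin m → ℝ, gaussianPDF 0 1 (∑ i, b i) ∂Measure.pi (fun _ => gaussianReal 0 1) =
      ENNReal.ofReal (√(2 * Real.pi * (m + 1)))⁻¹ := by
    have := lintegral_pi_gaussianPDF_add_sum m (v := 1) one_ne_zero 0
    simp only [zero_add] at this
    rw [this, gaussianPDF_zero]
    push_cast
    rw [add_comm (1 : ℝ)]
  have e4 : ∫⁻ c, Ψ c ∂Measure.pi (fun _ => gaussianReal 0 1) =
      ∫⁻ c, ‖∑ i, c i • l i‖ₑ ∂Measure.pi (fun _ : Fin (m + 1) => gaussianReal 0 1) := by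
    have hmp := (measurePreserving_piFinSuccAbove (fun _ : Fin (m + 1) => gaussianReal 0 1) 0).symm
    rw [← hmp.lintegral_comp_emb (MeasurableEquiv.measurableEmbedding _)]
    simp only [MeasurableEquiv.piFinSuccAbove_symm_apply, Fin.insertNthEquiv_apply,
      Fin.sum_univ_succ, Fin.insertNth_zero', Fin.cons_zero, Fin.cons_succ]
    rw [lintegral_prod_symm _ (by fun_prop)]
    refine lintegral_congr fun c => lintegral_congr fun w => ?_
    rw [add_comm]
    rfl
  rw [lintegral_prod_mul (f := fun b : Fin m → ℝ => gaussianPDF 0 1 (∑ i, b i)) (g := Ψ)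
    (by fun_prop) hΨ.aemeasurable, e3, e4] at e2
  rw [← e2]
  exact e1

/-- The expected volume of the zero set of a random superposition of plane waves. -/
theorem lintegral_zeros_wave [FiniteDimensional ℝ V] [MeasurableSpace V] [BorelSpace V]
    {k m : ℕ} (hk : Module.finrank ℝ V = k + 1) (l : Fin (m + 1) → V)
    {K : ℕ → Set V} (hKm : Monotone K) (hK : ∀ n, IsCompact (K n))
    (hfin : volume (⋃ n, K n) ≠ ∞) :
    ∫⁻ z, Measure.euclideanHausdorffMeasure k ((⋃ n, K n) ∩ {x | wave l z x = 0})
        ∂Measure.pi (fun _ : Fin (m + 1) => (gaussianReal 0 1).prod (gaussianReal 0 1)) =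
      ENNReal.ofReal (√(2 * Real.pi * (m + 1)))⁻¹ *
        (∫⁻ c, ‖∑ i, c i • l i‖ₑ ∂Measure.pi (fun _ : Fin (m + 1) => gaussianReal 0 1)) *
        volume (⋃ n, K n) := by
  have hpdf := measurable_gaussianPDF 0 1
  have hmp := (measurePreserving_piFinSuccAbove
    (fun _ : Fin (m + 1) => (gaussianReal 0 1).prod (gaussianReal 0 1)) 0).symm
  have hm := measurable_euclideanHausdorffMeasure_zeros k hKm hK (continuous_wave l)
  rw [← hmp.lintegral_comp hm]
  rw [lintegral_prod_symm _ (by exact (hm.comp (MeasurableEquiv.measurable _)).aemeasurable)]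
  have hcons : ∀ (p : ℝ × ℝ) (z : Fin m → ℝ × ℝ),
      (MeasurableEquiv.piFinSuccAbove (fun _ : Fin (m + 1) => ℝ × ℝ) 0).symm (p, z) =
        Fin.cons p z := fun p z => Fin.insertNth_zero' p z
  simp only [hcons, wave_cons]
  have e1 : ∀ z : Fin m → ℝ × ℝ, _ := fun z =>
    lintegral_prod_zeros_wave_add hk (contDiff_wave (Fin.tail l) z)
      ((continuous_waveGradient (Fin.tail l)).comp (Continuous.prodMk_right z))
      (fderiv_wave (Fin.tail l) z) (l 0) hKm hK hfin
  have hW := (continuous_wave (Fin.tail l)).measurable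
  have hG := (continuous_waveGradient (Fin.tail l)).measurable
  refine (lintegral_congr e1).trans ?_
  rw [lintegral_lintegral_swap]
  · refine (lintegral_congr fun x => lintegral_gaussianPDF_wave_mul l x).trans ?_
    rw [setLIntegral_const]
  · refine Measurable.aemeasurable ?_
    refine (hpdf.comp hW).mul ?_
    refine Measurable.lintegral_prod_right' (f := fun q : ((Fin m → ℝ × ℝ) × V) × ℝ =>
      ‖waveGradient (Fin.tail l) q.1.1 q.1.2 + q.2 • l 0‖ₑ) ?_
    exact ((hG.comp measurable_fst).add (by fun_prop)).enorm

end Wave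

/-! ### The mean norm of an isotropic Gaussian vector -/

section GaussianNorm

/-- A centred Gaussian law is determined by its covariance, and `h` says that the covariance is `σ²`
times the identity; the proof compares characteristic functions. -/
theorem map_sum_smul_pi_gaussian {V : Type*} [NormedAddCommGroup V] [InnerProductSpace ℝ V]
    [FiniteDimensional ℝ V] [MeasurableSpace V] [BorelSpace V] {n : ℕ} (l : Fin n → V) {σ : ℝ}
    (h : ∀ y, ∑ i, inner ℝ (l i) y ^ 2 = σ ^ 2 * ‖y‖ ^ 2) :
    (Measure.pi fun _ : Fin n => gaussianReal 0 1).map (fun c => ∑ i, c i • l i) =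
      (stdGaussian V).map (fun x => σ • x) := by
  have hm : Measurable fun c : Fin n → ℝ => ∑ i, c i • l i := by fun_prop
  have h1 : IsFiniteMeasure ((stdGaussian V).map (fun x => σ • x)) := by infer_instance
  have h2 : IsFiniteMeasure ((Measure.pi fun _ : Fin n => gaussianReal 0 1).map
      (fun c => ∑ i, c i • l i)) := by infer_instance
  refine Measure.ext_of_charFun (funext fun y => ?_)
  rw [charFun_map_smul, charFun_stdGaussian, charFun_apply,
    integral_map hm.aemeasurable (Measurable.aestronglyMeasurable (by fun_prop))]
  have e1 : ∀ c : Fin n → ℝ, Complex.exp ((inner ℝ (∑ i, c i • l i) y : ℝ) * Complex.I) =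
      ∏ i, Complex.exp ((inner ℝ (l i) y : ℝ) * (c i : ℝ) * Complex.I) := fun c => by
    rw [← Complex.exp_sum, sum_inner]
    congr 1
    push_cast
    rw [Finset.sum_mul]
    refine Finset.sum_congr rfl fun i _ => ?_
    rw [inner_smul_left]
    simp
    ring
  simp_rw [e1]
  rw [integral_fintype_prod_eq_prod (f := fun i (x : ℝ) =>
    Complex.exp ((inner ℝ (l i) y : ℝ) * (x : ℝ) * Complex.I))]
  simp_rw [← charFun_apply_real, charFun_gaussianReal]
  rw [← Complex.exp_sum, norm_smul, ← Complex.ofReal_pow, mul_pow, Real.norm_eq_abs,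
    sq_abs, ← h y]
  congr 1
  push_cast
  rw [← Finset.sum_neg_distrib, Finset.sum_div]
  refine Finset.sum_congr rfl fun i _ => ?_
  simp
  ring

theorem stdGaussian_eq_withDensity (V : Type*) [NormedAddCommGroup V] [InnerProductSpace ℝ V]
    [FiniteDimensional ℝ V] [MeasurableSpace V] [BorelSpace V] :
    stdGaussian V = volume.withDensity fun x => ENNReal.ofReal
      ((2 * Real.pi) ^ (-(Module.finrank ℝ V / 2 : ℝ)) * Real.exp (-(1 / 2) * ‖x‖ ^ 2)) := by
  have hb : 0 < (1 / 2 : ℂ).re := by norm_num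
  have hint : Integrable (fun x : V =>
      (2 * Real.pi) ^ (-(Module.finrank ℝ V / 2 : ℝ)) * Real.exp (-(1 / 2) * ‖x‖ ^ 2)) := by
    refine Integrable.const_mul ?_ _
    have := (GaussianFourier.integrable_cexp_neg_mul_sq_norm_add hb 0 (0 : V)).norm
    refine this.congr (Eventually.of_forall fun x => ?_)
    simp [Complex.norm_exp, ← Complex.ofReal_pow]
  have := isFiniteMeasure_withDensity_ofReal hint.2
  refine Measure.ext_of_charFun (funext fun y => ?_)
  rw [charFun_stdGaussian, charFun_apply, integral_withDensity_eq_integral_toReal_smul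
    (by fun_prop) (Eventually.of_forall fun _ => ENNReal.ofReal_lt_top)]
  have h1 : ∀ x : V, (ENNReal.ofReal ((2 * Real.pi) ^ (-(Module.finrank ℝ V / 2 : ℝ)) *
      Real.exp (-(1 / 2) * ‖x‖ ^ 2))).toReal • Complex.exp ((inner ℝ x y : ℝ) * Complex.I) =
      ((2 * Real.pi : ℝ) ^ (-(Module.finrank ℝ V / 2 : ℝ)) : ℝ) *
        Complex.exp (-(1 / 2) * ‖x‖ ^ 2 + Complex.I * (inner ℝ y x : ℝ)) := fun x => by
    rw [ENNReal.toReal_ofReal (by positivity), Complex.real_smul, Complex.exp_add,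
      real_inner_comm, mul_comm Complex.I]
    push_cast
    ring
  simp_rw [h1]
  rw [integral_const_mul, GaussianFourier.integral_cexp_neg_mul_sq_norm_add hb]
  have h2 : (Real.pi : ℂ) / (1 / 2) = (2 * Real.pi : ℝ) := by push_cast; ring
  have h3 : (((2 * Real.pi : ℝ) : ℂ) ^ ((Module.finrank ℝ V : ℂ) / 2)) =
      (((2 * Real.pi : ℝ) ^ (Module.finrank ℝ V / 2 : ℝ) : ℝ) : ℂ) := by
    rw [Complex.ofReal_cpow (by positivity)]
    push_cast
    rfl
  rw [h2, h3, ← mul_assoc, ← Complex.ofReal_mul, ← Real.rpow_add (by positivity), neg_add_cancel,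
    Real.rpow_zero, Complex.ofReal_one, one_mul, Complex.I_sq]
  congr 1
  ring

/-- The mean norm of a standard Gaussian vector. -/
theorem lintegral_enorm_stdGaussian (k : ℕ) :
    ∫⁻ x, ‖x‖ₑ ∂stdGaussian (EuclideanSpace ℝ (Fin (k + 1))) =
      ENNReal.ofReal (√2 * (Real.Gamma (((k + 1 : ℕ) + 1 : ℝ) / 2) /
        Real.Gamma (((k + 1 : ℕ) : ℝ) / 2))) := by
  have hint : Integrable (fun x => x) (stdGaussian (EuclideanSpace ℝ (Fin (k + 1)))) :=
    IsGaussian.integrable_id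
  rw [← ofReal_integral_norm_eq_lintegral_enorm hint]
  congr 1
  rw [stdGaussian_eq_withDensity, integral_withDensity_eq_integral_toReal_smul (by fun_prop)
    (Eventually.of_forall fun _ => ENNReal.ofReal_lt_top)]
  have h1 : ∀ x : EuclideanSpace ℝ (Fin (k + 1)), (ENNReal.ofReal ((2 * Real.pi) ^
      (-(Module.finrank ℝ (EuclideanSpace ℝ (Fin (k + 1))) / 2 : ℝ)) *
      Real.exp (-(1 / 2) * ‖x‖ ^ 2))).toReal • ‖x‖ =
      (fun r : ℝ => (2 * Real.pi) ^ (-(((k + 1 : ℕ) : ℝ) / 2)) *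
        (r * Real.exp (-(1 / 2) * r ^ 2))) ‖x‖ := fun x => by
    rw [ENNReal.toReal_ofReal (by positivity), finrank_euclideanSpace_fin, smul_eq_mul]
    ring
  simp_rw [h1]
  rw [integral_fun_norm_addHaar volume (fun r : ℝ => (2 * Real.pi) ^ (-(((k + 1 : ℕ) : ℝ) / 2)) *
        (r * Real.exp (-(1 / 2) * r ^ 2))), finrank_euclideanSpace_fin, Measure.real,
        EuclideanSpace.volume_ball]
  have h2 : ∫ y in Ioi (0 : ℝ), y ^ (k + 1 - 1) • ((2 * Real.pi) ^ (-(((k + 1 : ℕ) : ℝ) / 2)) *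
        (y * Real.exp (-(1 / 2) * y ^ 2))) = (2 * Real.pi) ^ (-(((k + 1 : ℕ) : ℝ) / 2)) *
        ((1 / 2) ^ (-(((k + 1 : ℕ) : ℝ) + 1) / 2) * (1 / 2) *
          Real.Gamma ((((k + 1 : ℕ) : ℝ) + 1) / 2)) := by
    rw [← integral_rpow_mul_exp_neg_mul_rpow (p := 2) (q := ((k + 1 : ℕ) : ℝ)) two_pos
      (by push_cast; linarith [Nat.cast_nonneg (α := ℝ) k]) (b := 1 / 2) (by norm_num),
      ← integral_const_mul]
    refine setIntegral_congr_fun measurableSet_Ioi fun y hy => ?_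
    simp only [Nat.add_sub_cancel, smul_eq_mul, Real.rpow_natCast, Real.rpow_two, pow_succ]
    ring
  rw [h2]
  have hn : (0 : ℝ) < ((k + 1 : ℕ) : ℝ) := by positivity
  have hpi : √Real.pi ^ (k + 1) = Real.pi ^ (((k + 1 : ℕ) : ℝ) / 2) := by
    rw [Real.sqrt_eq_rpow, ← Real.rpow_natCast, ← Real.rpow_mul Real.pi_pos.le]
    congr 1; ring
  rw [ENNReal.toReal_mul, ENNReal.toReal_pow, ENNReal.toReal_ofReal zero_le_one, one_pow, one_mul,
    ENNReal.toReal_ofReal (by positivity), Fintype.card_fin, hpi, nsmul_eq_mul, smul_eq_mul]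
  generalize ((k + 1 : ℕ) : ℝ) = n at hn ⊢
  have hΓ := Real.Gamma_pos_of_pos (half_pos hn)
  have e1 : (1 / 2 : ℝ) ^ (-(n + 1) / 2) = 2 ^ (n / 2) * √2 := by
    rw [one_div, Real.inv_rpow two_pos.le, ← Real.rpow_neg two_pos.le, Real.sqrt_eq_rpow,
      ← Real.rpow_add two_pos]
    congr 1; ring
  -- `Γ(n/2 + 1) = (n/2) Γ(n/2)` turns `n` times the volume of the ball into the area of the sphere,
  -- so `n` cancels.
  rw [Real.Gamma_add_one (half_pos hn).ne', e1, Real.rpow_neg (by positivity),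
    Real.mul_rpow two_pos.le Real.pi_pos.le]
  have h4 : (0 : ℝ) < 2 ^ (n / 2) := by positivity
  have h5 : (0 : ℝ) < Real.pi ^ (n / 2) := by positivity
  field_simp

end GaussianNorm

/-! ### From the torus to the unit cube -/

section Torus

variable {d : ℕ}

/-- Hausdorff measure is intrinsic: both sides equal that of the subtype `S`, so only distances
within `S` matter. -/
theorem euclideanHausdorffMeasure_image_of_isometryOn {X Y : Type*} [EMetricSpace X]
    [MeasurableSpace X] [BorelSpace X] [EMetricSpace Y] [MeasurableSpace Y] [BorelSpace Y]
    {f : X → Y} {S : Set X} (hf : ∀ x ∈ S, ∀ y ∈ S, edist (f x) (f y) = edist x y) (k : ℕ) :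
    Measure.euclideanHausdorffMeasure k (f '' S) = Measure.euclideanHausdorffMeasure k S := by
  have h1 : Isometry fun x : S => f x := fun x y => hf x x.2 y y.2
  have h2 := h1.euclideanHausdorffMeasure_image (d := k) univ
  have h3 := (isometry_subtype_coe (s := S)).euclideanHausdorffMeasure_image (d := k) univ
  rw [image_univ, Subtype.range_coe] at h3
  rw [h3, ← h2, image_univ, ← image_eq_range]

/-- The half-open unit cube, a fundamental domain of the torus. -/
def unitCube (d : ℕ) : Set (EuclideanSpace ℝ (Fin d)) := {x | ∀ i, 0 ≤ x i ∧ x i < 1}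

/-- Compact cubes which exhaust the half-open unit cube. -/
def compactCube (d n : ℕ) : Set (EuclideanSpace ℝ (Fin d)) :=
  {x | ∀ i, 0 ≤ x i ∧ x i ≤ 1 - 1 / ((n : ℝ) + 1)}

theorem monotone_compactCube : Monotone (compactCube d) := fun m n hmn x hx i => by
  refine ⟨(hx i).1, (hx i).2.trans ?_⟩
  have : (m : ℝ) ≤ n := by exact_mod_cast hmn
  gcongr

theorem isCompact_compactCube (n : ℕ) : IsCompact (compactCube d n) := by
  have h := (isCompact_univ_pi fun _ : Fin d =>
    isCompact_Icc (a := (0 : ℝ)) (b := 1 - 1 / ((n : ℝ) + 1))).image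
      (PiLp.continuous_toLp 2 fun _ : Fin d => ℝ)
  convert h
  ext x
  constructor
  · intro hx
    exact ⟨x.ofLp, fun i _ => hx i, rfl⟩
  · rintro ⟨y, hy, rfl⟩ i
    exact hy i (mem_univ i)

theorem iUnion_compactCube : ⋃ n, compactCube d n = unitCube d := by
  ext x
  rw [mem_iUnion]
  constructor
  · rintro ⟨n, hn⟩ i
    refine ⟨(hn i).1, (hn i).2.trans_lt ?_⟩
    have : 0 < 1 / ((n : ℝ) + 1) := by positivity
    linarith
  · intro hx
    have h : ∀ i, ∃ n : ℕ, 1 / ((n : ℝ) + 1) < 1 - x i := fun i =>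
      exists_nat_one_div_lt (sub_pos.2 (hx i).2)
    choose n hn using h
    refine ⟨Finset.univ.sup n, fun i => ⟨(hx i).1, ?_⟩⟩
    have h1 : 1 / (((Finset.univ.sup n : ℕ) : ℝ) + 1) ≤ 1 / ((n i : ℝ) + 1) := by
      have : (n i : ℝ) ≤ (Finset.univ.sup n : ℕ) := by
        exact_mod_cast Finset.le_sup (f := n) (Finset.mem_univ i)
      gcongr
    linarith [hn i]

theorem measurableSet_unitCube : MeasurableSet (unitCube d) := by
  rw [← iUnion_compactCube]
  exact MeasurableSet.iUnion fun n => (isCompact_compactCube n).measurableSet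

theorem volume_unitCube : volume (unitCube d) = 1 := by
  have h : unitCube d = (WithLp.ofLp : EuclideanSpace ℝ (Fin d) → Fin d → ℝ) ⁻¹'
      (univ.pi fun _ => Ico 0 1) := by
    ext x
    simp [unitCube, Set.mem_pi]
  rw [h, (PiLp.volume_preserving_ofLp (Fin d)).measure_preimage
    (MeasurableSet.univ_pi fun _ => measurableSet_Ico).nullMeasurableSet, Real.volume_pi_Ico]
  simp

theorem continuous_toTorus : Continuous (toTorus (d := d)) := by
  refine (PiLp.continuous_toLp 2 fun _ : Fin d => UnitAddCircle).comp (continuous_pi fun i => ?_)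
  exact (AddCircle.continuous_mk' (1 : ℝ)).comp (PiLp.continuous_apply 2 _ i)

theorem injOn_toTorus : InjOn (toTorus (d := d)) (unitCube d) := by
  intro x hx y hy hxy
  ext i
  have h : ((x i : ℝ) : UnitAddCircle) = ((y i : ℝ) : UnitAddCircle) :=
    congrFun (congrArg WithLp.ofLp hxy) i
  have hI : ∀ z ∈ unitCube d, z i ∈ Ico (0 : ℝ) (0 + 1) := fun z hz => by simpa using hz i
  exact (AddCircle.coe_eq_coe_iff_of_mem_Ico (hI x hx) (hI y hy)).1 h

theorem edist_toTorus {x y : EuclideanSpace ℝ (Fin d)} (h : ∀ i, |x i - y i| ≤ 1 / 2) :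
    edist (toTorus x) (toTorus y) = edist x y := by
  have h1 : ∀ i, dist (toTorus x i) (toTorus y i) = dist (x i) (y i) := fun i => by
    change dist ((x i : ℝ) : UnitAddCircle) ((y i : ℝ) : UnitAddCircle) = dist (x i) (y i)
    rw [dist_eq_norm, dist_eq_norm, Real.norm_eq_abs, ← AddCircle.coe_sub,
      AddCircle.norm_coe_eq_abs_iff _ one_ne_zero]
    simpa using h i
  rw [edist_dist, edist_dist, PiLp.dist_eq_of_L2, EuclideanSpace.dist_eq]
  simp_rw [h1]

/-- The quotient map preserves the Hausdorff measures of subsets of the fundamental domain. -/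
theorem euclideanHausdorffMeasure_image_toTorus {S : Set (EuclideanSpace ℝ (Fin d))}
    (hS : MeasurableSet S) (hSQ : S ⊆ unitCube d) (k : ℕ) :
    Measure.euclideanHausdorffMeasure k (toTorus '' S) =
      Measure.euclideanHausdorffMeasure k S := by
  -- Halving every side gives `2^d` subcubes in which coordinates differ by at most `1/2`, so the
  -- quotient map is an isometry on each.
  let R : (Fin d → Bool) → Set (EuclideanSpace ℝ (Fin d)) := fun j =>
    S ∩ ⋂ i, {x | decide (1 / 2 ≤ x i) = j i}
  have hR : ∀ j, MeasurableSet (R j) := fun j => by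
    refine hS.inter (MeasurableSet.iInter fun i => ?_)
    have : MeasurableSet {x : EuclideanSpace ℝ (Fin d) | 1 / 2 ≤ x i} :=
      measurableSet_le measurable_const (by fun_prop)
    have this' : MeasurableSet {x : EuclideanSpace ℝ (Fin d) | x i < 1 / 2} :=
      measurableSet_lt (by fun_prop) measurable_const
    cases h : j i
    · simpa [h] using this'
    · simpa [h] using this
  have hRS : ⋃ j, R j = S := by
    rw [← inter_iUnion, inter_eq_left]
    intro x _
    exact mem_iUnion.2 ⟨fun i => decide (1 / 2 ≤ x i), mem_iInter.2 fun i => rfl⟩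
  have hRd : Pairwise (Function.onFun Disjoint R) := fun j j' hjj => by
    rw [Function.onFun, Set.disjoint_left]
    rintro x ⟨-, h1⟩ ⟨-, h2⟩
    exact hjj (funext fun i => (mem_iInter.1 h1 i).symm.trans (mem_iInter.1 h2 i))
  have hRQ : ∀ j, R j ⊆ unitCube d := fun j => inter_subset_left.trans hSQ
  conv_lhs => rw [← hRS, image_iUnion]
  conv_rhs => rw [← hRS]
  rw [measure_iUnion hRd hR, measure_iUnion (fun j j' hjj => ?_) fun j =>
    (hR j).image_of_continuousOn_injOn continuous_toTorus.continuousOn (injOn_toTorus.mono (hRQ j))]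
  · refine tsum_congr fun j => euclideanHausdorffMeasure_image_of_isometryOn (fun x hx y hy => ?_) k
    refine edist_toTorus fun i => ?_
    have h1 := hRQ j hx i
    have h2 := hRQ j hy i
    have h3 : (1 / 2 ≤ x i) ↔ (1 / 2 ≤ y i) :=
      decide_eq_decide.1 ((mem_iInter.1 hx.2 i).trans (mem_iInter.1 hy.2 i).symm)
    rw [abs_le]
    by_cases h : 1 / 2 ≤ x i
    · have := h3.1 h
      constructor <;> linarith
    · have := not_le.1 fun h' => h (h3.2 h')
      rw [not_le] at h
      constructor <;> linarith
  · rw [Function.onFun, Set.disjoint_iff_inter_eq_empty,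
      ← (injOn_toTorus.mono (union_subset (hRQ j) (hRQ j'))).image_inter
        subset_union_left subset_union_right, (hRd hjj).inter_eq, image_empty]

theorem pairing_sub_int (l n : Fin d → ℤ) (x : EuclideanSpace ℝ (Fin d)) :
    pairing l (WithLp.toLp 2 fun i => x i - n i) = pairing l x - (∑ i, l i * n i : ℤ) := by
  simp only [pairing, mul_sub, Finset.sum_sub_distrib]
  push_cast
  rfl

theorem eigenfunction_sub_int (E : ℕ) (b c : (Fin d → ℤ) → ℝ) (n : Fin d → ℤ)
    (x : EuclideanSpace ℝ (Fin d)) :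
    eigenfunction d E b c (WithLp.toLp 2 fun i => x i - n i) = eigenfunction d E b c x := by
  unfold eigenfunction
  congr 1
  refine Finset.sum_congr rfl fun l _ => ?_
  rw [pairing_sub_int, mul_sub, mul_comm (2 * Real.pi) (((∑ i, l i * n i : ℤ)) : ℝ),
    Real.cos_sub_int_mul_two_pi, Real.sin_sub_int_mul_two_pi]

theorem continuous_eigenfunction (E : ℕ) (b c : (Fin d → ℤ) → ℝ) :
    Continuous (eigenfunction d E b c) := by
  unfold eigenfunction pairing
  fun_prop

theorem nodalVolume_eq (E : ℕ) (b c : (Fin d → ℤ) → ℝ) :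
    nodalVolume d E b c = Measure.euclideanHausdorffMeasure (d - 1)
      (unitCube d ∩ {x | eigenfunction d E b c x = 0}) := by
  have h : nodalSet d E b c = toTorus '' (unitCube d ∩ {x | eigenfunction d E b c x = 0}) := by
    refine Subset.antisymm ?_ (image_mono inter_subset_right)
    rintro _ ⟨x, hx, rfl⟩
    refine ⟨WithLp.toLp 2 fun i => x i - ⌊x i⌋, ⟨fun i => ?_, ?_⟩, ?_⟩
    · exact ⟨Int.fract_nonneg _, Int.fract_lt_one _⟩
    · exact (eigenfunction_sub_int E b c (fun i => ⌊x i⌋) x).trans hx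
    · unfold toTorus
      congr 1
      funext i
      change ((x i - ⌊x i⌋ : ℝ) : UnitAddCircle) = ((x i : ℝ) : UnitAddCircle)
      rw [AddCircle.coe_sub, sub_eq_self, AddCircle.coe_eq_zero_iff]
      exact ⟨⌊x i⌋, by simp⟩
  rw [nodalVolume, h, euclideanHausdorffMeasure_image_toTorus _ inter_subset_left]
  exact measurableSet_unitCube.inter
    (measurableSet_eq_fun (continuous_eigenfunction E b c).measurable measurable_const)

end Torus

/-! ### Lattice symmetries and assembly -/

section Lattice

variable {d E : ℕ}

theorem sum_frequencies_comp (σ : (Fin d → ℤ) ≃ (Fin d → ℤ))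
    (hσ : ∀ l, ∑ i, σ l i ^ 2 = ∑ i, l i ^ 2) (f : (Fin d → ℤ) → ℝ) :
    ∑ l ∈ frequencies d E, f (σ l) = ∑ l ∈ frequencies d E, f l :=
  Finset.sum_equiv σ (fun l => by rw [mem_frequencies, mem_frequencies, hσ]) fun _ _ => rfl

/-- The reflection `l i ↦ -l i` preserves `Λ_E` and changes the sign of the sum. -/
theorem sum_frequencies_mul_of_ne {i j : Fin d} (hij : i ≠ j) :
    ∑ l ∈ frequencies d E, (l i : ℝ) * l j = 0 := by
  let σ : (Fin d → ℤ) ≃ (Fin d → ℤ) :=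
    Equiv.piCongrRight fun k => if k = i then Equiv.neg ℤ else Equiv.refl ℤ
  have hσ : ∀ l k, σ l k = if k = i then -l k else l k := fun l k => by
    simp only [σ, Equiv.piCongrRight_apply, Pi.map_apply]
    split_ifs <;> rfl
  have h := sum_frequencies_comp (E := E) σ
    (fun l => Finset.sum_congr rfl fun k _ => by rw [hσ]; split_ifs <;> ring)
    fun l => (l i : ℝ) * l j
  simp only [hσ, if_pos, if_neg hij.symm] at h
  push_cast at h
  simp only [neg_mul, Finset.sum_neg_distrib] at h
  linarith

theorem sum_frequencies_sq (i j : Fin d) :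
    ∑ l ∈ frequencies d E, (l i : ℝ) ^ 2 = ∑ l ∈ frequencies d E, (l j : ℝ) ^ 2 := by
  have h := sum_frequencies_comp (E := E) (Equiv.arrowCongr (Equiv.swap i j) (Equiv.refl ℤ))
    (fun l => Equiv.sum_comp (Equiv.swap i j).symm fun k => l k ^ 2) fun l => (l j : ℝ) ^ 2
  rw [← h]
  simp

/-- Reflections kill the off-diagonal second moments and transpositions equate the diagonal ones;
their total `𝒩 E` then fixes the scalar. -/
theorem sum_frequencies_inner_sq (hd : d ≠ 0) (y : EuclideanSpace ℝ (Fin d)) :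
    ∑ l ∈ frequencies d E, pairing l y ^ 2 =
      (frequencies d E).card * E / d * ‖y‖ ^ 2 := by
  have hdiag : ∀ i : Fin d, ∑ l ∈ frequencies d E, (l i : ℝ) ^ 2 =
      (frequencies d E).card * E / d := by
    intro i
    have h1 : ∑ j : Fin d, ∑ l ∈ frequencies d E, (l j : ℝ) ^ 2 = (frequencies d E).card * E := by
      rw [Finset.sum_comm, Finset.sum_congr rfl fun l hl => ?_, Finset.sum_const, nsmul_eq_mul]
      exact_mod_cast mem_frequencies.1 hl
    rw [Finset.sum_congr rfl fun j _ => sum_frequencies_sq j i, Finset.sum_const,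
      Finset.card_univ, Fintype.card_fin, nsmul_eq_mul] at h1
    rw [← h1]
    field_simp
  have hoff : ∀ i j : Fin d, ∑ l ∈ frequencies d E, (l i : ℝ) * l j =
      if i = j then ((frequencies d E).card * E / d : ℝ) else 0 := fun i j => by
    split_ifs with h
    · rw [← h, ← hdiag i]
      exact Finset.sum_congr rfl fun l _ => (sq _).symm
    · exact sum_frequencies_mul_of_ne h
  calc ∑ l ∈ frequencies d E, pairing l y ^ 2
      = ∑ l ∈ frequencies d E, ∑ i, ∑ j, (y i * y j) * ((l i : ℝ) * l j) := by
        refine Finset.sum_congr rfl fun l _ => ?_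
        rw [pairing, sq, Finset.sum_mul_sum]
        exact Finset.sum_congr rfl fun i _ => Finset.sum_congr rfl fun j _ => by ring
    _ = ∑ i, ∑ j, (y i * y j) * ∑ l ∈ frequencies d E, (l i : ℝ) * l j := by
        rw [Finset.sum_comm]
        refine Finset.sum_congr rfl fun i _ => ?_
        rw [Finset.sum_comm]
        exact Finset.sum_congr rfl fun j _ => (Finset.mul_sum _ _ _).symm
    _ = _ := by
        simp_rw [hoff]
        simp only [mul_ite, mul_zero, Finset.sum_ite_eq, Finset.mem_univ, if_true]
        rw [EuclideanSpace.real_norm_sq_eq, Finset.mul_sum]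
        exact Finset.sum_congr rfl fun i _ => by ring

open Classical in
/-- One frequency out of each pair of opposite ones. -/
noncomputable def halfFrequencies (d E : ℕ) : Finset (Fin d → ℤ) :=
  (frequencies d E).filter fun l => 0 < toLex l

open Classical in
theorem mem_halfFrequencies {l : Fin d → ℤ} :
    l ∈ halfFrequencies d E ↔ l ∈ frequencies d E ∧ 0 < toLex l :=
  Finset.mem_filter

theorem neg_mem_frequencies {l : Fin d → ℤ} : -l ∈ frequencies d E ↔ l ∈ frequencies d E := by
  simp [mem_frequencies]

theorem neg_notMem_halfFrequencies {l : Fin d → ℤ} (hl : l ∈ halfFrequencies d E) :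
    -l ∉ halfFrequencies d E := by
  intro h
  have h1 := (mem_halfFrequencies.1 hl).2
  have h2 : 0 < -toLex l := (mem_halfFrequencies.1 h).2
  exact lt_asymm h1 (neg_pos.1 h2)

open Classical in
theorem sum_frequencies_of_even (hE : E ≠ 0) (f : (Fin d → ℤ) → ℝ)
    (hf : ∀ l ∈ frequencies d E, f (-l) = f l) :
    ∑ l ∈ frequencies d E, f l = 2 * ∑ l ∈ halfFrequencies d E, f l := by
  rw [← Finset.sum_filter_add_sum_filter_not _ (fun l => 0 < toLex l), two_mul]
  congr 1
  refine (Finset.sum_nbij' (fun l => -l) (fun l => -l) ?_ ?_ ?_ ?_ ?_).symm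
  · intro l hl
    have h := Finset.mem_filter.1 hl
    refine Finset.mem_filter.2 ⟨neg_mem_frequencies.2 h.1, not_lt.2 ?_⟩
    exact (neg_neg_of_pos h.2).le
  · intro l hl
    have h := Finset.mem_filter.1 hl
    refine Finset.mem_filter.2 ⟨neg_mem_frequencies.2 h.1, ?_⟩
    -- As `E ≠ 0`, the zero frequency is absent, so negation exchanges the two halves.
    have h0 : toLex l ≠ 0 := fun h0 => by
      have h1 := mem_frequencies.1 h.1
      have h2 : l = 0 := h0
      rw [h2] at h1
      simp at h1
      exact hE (by exact_mod_cast h1.symm)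
    exact neg_pos.2 (lt_of_le_of_ne (not_lt.1 h.2) h0)
  · simp
  · simp
  · intro l hl
    exact (hf l (Finset.mem_filter.1 hl).1).symm

theorem card_frequencies (hE : E ≠ 0) :
    ((frequencies d E).card : ℝ) = 2 * (halfFrequencies d E).card := by
  simpa using sum_frequencies_of_even (d := d) hE (fun _ => 1) fun _ _ => rfl

theorem eigenfunction_eq_zero_iff (hE : E ≠ 0) (hN : (frequencies d E).Nonempty)
    {b c : (Fin d → ℤ) → ℝ} (hb : ∀ l ∈ frequencies d E, b (-l) = b l)
    (hc : ∀ l ∈ frequencies d E, c (-l) = -c l) {n : ℕ} (e : Fin n ≃ halfFrequencies d E)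
    (x : EuclideanSpace ℝ (Fin d)) :
    eigenfunction d E b c x = 0 ↔
      wave (fun i => (2 * Real.pi) • (WithLp.toLp 2 fun j => ((e i : Fin d → ℤ) j : ℝ) :
        EuclideanSpace ℝ (Fin d))) (fun i => (b (e i), c (e i))) x = 0 := by
  have hpos : 0 < 1 / √(2 * ((frequencies d E).card : ℝ)) := by
    have : 0 < (frequencies d E).card := Finset.card_pos.2 hN
    positivity
  have hin : ∀ l : Fin d → ℤ, inner ℝ ((2 * Real.pi) • (WithLp.toLp 2 fun j => ((l j : ℤ) : ℝ) :
      EuclideanSpace ℝ (Fin d))) x = 2 * Real.pi * pairing l x := fun l => by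
    rw [real_inner_smul_left, pairing, PiLp.inner_apply]
    congr 1
    exact Finset.sum_congr rfl fun j _ => by simp [mul_comm]
  have hneg : ∀ l : Fin d → ℤ, pairing (-l) x = -pairing l x := fun l => by
    simp [pairing]
  rw [eigenfunction, sum_frequencies_of_even hE _ fun l hl => by
    rw [hb l hl, hc l hl, hneg, mul_neg, Real.cos_neg, Real.sin_neg]; ring]
  simp only [wave, hin]
  rw [mul_eq_zero, mul_eq_zero, or_iff_right hpos.ne', or_iff_right two_ne_zero,
    ← Finset.sum_coe_sort, ← e.sum_comp]

/-- The chosen half contains no two opposite frequencies, so `indep` applies to it; the rest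
regroups `2n` independent normals into `n` pairs. -/
theorem hasLaw_coefficients {Ω : Type*} [MeasurableSpace Ω] {P : Measure Ω}
    [IsProbabilityMeasure P] {b c : (Fin d → ℤ) → Ω → ℝ} (hbc : IsGaussianCoefficients P d E b c)
    {n : ℕ} (e : Fin n ≃ halfFrequencies d E) :
    HasLaw (fun ω i => (b (e i) ω, c (e i) ω))
      (Measure.pi fun _ : Fin n => (gaussianReal 0 1).prod (gaussianReal 0 1)) P := by
  have hH : ∀ i, (e i : Fin d → ℤ) ∈ frequencies d E := fun i =>
    (mem_halfFrequencies.1 (e i).2).1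
  let X : Fin n ⊕ Fin n → Ω → ℝ := Sum.elim (fun i => b (e i)) (fun i => c (e i))
  have hX : ∀ i, HasLaw (X i) (gaussianReal 0 1) P := by
    rintro (i | i)
    · exact hbc.law_b _ (hH i)
    · exact hbc.law_c _ (hH i)
  have hind : iIndepFun X P := by
    have h := (hbc.indep (halfFrequencies d E) (fun l hl => (mem_halfFrequencies.1 hl).1)
      fun l hl => neg_notMem_halfFrequencies hl).precomp (g := Sum.map e e)
      (Sum.map_injective.2 ⟨e.injective, e.injective⟩)
    convert h using 2 with i
    rcases i with i | i <;> rfl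
  have hmap := (iIndepFun_iff_map_fun_eq_pi_map fun i => (hX i).aemeasurable).1 hind
  simp_rw [(hX _).map_eq] at hmap
  have hlaw : HasLaw (fun ω i => X i ω) (Measure.pi fun _ : Fin n ⊕ Fin n => gaussianReal 0 1) P :=
    ⟨aemeasurable_pi_lambda _ fun i => (hX i).aemeasurable, hmap⟩
  have h1 := measurePreserving_sumPiEquivProdPi (X := fun _ : Fin n ⊕ Fin n => ℝ)
    fun _ => gaussianReal 0 1
  have h2 := (measurePreserving_arrowProdEquivProdArrow ℝ ℝ (Fin n)
    (fun _ => gaussianReal 0 1) (fun _ => gaussianReal 0 1)).symm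
  exact ((h2.comp h1).hasLaw).comp hlaw

/-- The number `n` of retained frequencies enters the density at `0` as `n^(-1/2)` and the standard
deviation of the gradient as `n^(1/2)`. -/
theorem nodalConstant_mul_sqrt {d n : ℕ} (hd : d ≠ 0) (hn : n ≠ 0) (E : ℕ) :
    (√(2 * Real.pi * n))⁻¹ * (2 * Real.pi * √(n * E / d) * (√2 * (Real.Gamma ((d + 1 : ℝ) / 2) /
      Real.Gamma ((d : ℝ) / 2)))) = nodalConstant d * √(E : ℝ) := by
  have hd0 : (0 : ℝ) < d := by positivity
  have hn0 : (0 : ℝ) < n := by positivity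
  have h : (√(2 * Real.pi * n))⁻¹ * (2 * Real.pi * √(n * E / d) * √2) =
      √(4 * Real.pi / d) * √(E : ℝ) := by
    have h2 : 2 * Real.pi = √((2 * Real.pi) ^ 2) := (Real.sqrt_sq (by positivity)).symm
    rw [← Real.sqrt_inv]
    conv_lhs => rw [h2, ← Real.sqrt_mul (by positivity), ← Real.sqrt_mul (by positivity),
      ← Real.sqrt_mul (by positivity)]
    rw [← Real.sqrt_mul (by positivity)]
    congr 1
    rw [Real.sqrt_sq (by positivity)]
    field_simp
    ring
  rw [nodalConstant]
  linear_combination (Real.Gamma ((d + 1 : ℝ) / 2) / Real.Gamma ((d : ℝ) / 2)) * h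

theorem lintegral_nodalVolume {Ω : Type*} [MeasurableSpace Ω] (P : Measure Ω)
    [IsProbabilityMeasure P] (d E : ℕ) (hd : 1 ≤ d) (hE : E ≠ 0)
    (hN : (frequencies d E).Nonempty) (b c : (Fin d → ℤ) → Ω → ℝ)
    (hbc : IsGaussianCoefficients P d E b c) :
    AEMeasurable (fun ω => nodalVolume d E (fun l => b l ω) (fun l => c l ω)) P ∧
    ∫⁻ ω, nodalVolume d E (fun l => b l ω) (fun l => c l ω) ∂P =
      ENNReal.ofReal (nodalConstant d * √(E : ℝ)) := by
  obtain ⟨k, rfl⟩ : ∃ k, d = k + 1 := ⟨d - 1, by omega⟩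
  have hcard : (halfFrequencies (k + 1) E).card ≠ 0 := fun h => by
    have h1 := card_frequencies (d := k + 1) hE
    rw [h] at h1
    have h2 : (0 : ℝ) < (frequencies (k + 1) E).card := by exact_mod_cast Finset.card_pos.2 hN
    rw [h1] at h2
    simp at h2
  obtain ⟨m, hm⟩ := Nat.exists_eq_succ_of_ne_zero hcard
  let e : Fin (m + 1) ≃ halfFrequencies (k + 1) E :=
    ((halfFrequencies (k + 1) E).equivFinOfCardEq hm).symm
  let l : Fin (m + 1) → EuclideanSpace ℝ (Fin (k + 1)) := fun i =>
    (2 * Real.pi) • WithLp.toLp 2 fun j => ((e i : Fin (k + 1) → ℤ) j : ℝ)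
  let F : (Fin (m + 1) → ℝ × ℝ) → ℝ≥0∞ := fun z =>
    Measure.euclideanHausdorffMeasure k ((⋃ n, compactCube (k + 1) n) ∩ {x | wave l z x = 0})
  have hF : Measurable F := measurable_euclideanHausdorffMeasure_zeros k monotone_compactCube
    isCompact_compactCube (continuous_wave l)
  have hZ : (fun ω => nodalVolume (k + 1) E (fun l => b l ω) (fun l => c l ω)) =
      fun ω => F fun i => (b (e i) ω, c (e i) ω) := by
    funext ω
    rw [nodalVolume_eq, Nat.add_sub_cancel]
    simp only [F]
    rw [iUnion_compactCube]
    congr 2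
    ext x
    exact eigenfunction_eq_zero_iff hE hN (fun l hl => hbc.b_neg l hl ω)
      (fun l hl => hbc.c_neg l hl ω) e x
  have hlaw := hasLaw_coefficients hbc e
  have hvol : volume (⋃ n, compactCube (k + 1) n) = 1 := by
    rw [iUnion_compactCube, volume_unitCube]
  have hiso : ∀ y, ∑ i, inner ℝ (l i) y ^ 2 =
      (2 * Real.pi * √((m + 1 : ℕ) * E / (k + 1 : ℕ))) ^ 2 * ‖y‖ ^ 2 := by
    intro y
    have hin : ∀ i, inner ℝ (l i) y = 2 * Real.pi * pairing (e i : Fin (k + 1) → ℤ) y := fun i => by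
      rw [real_inner_smul_left, pairing, PiLp.inner_apply]
      congr 1
      exact Finset.sum_congr rfl fun j _ => by simp [mul_comm]
    have h1 := sum_frequencies_inner_sq (E := E) (Nat.succ_ne_zero k) y
    -- The second moment and the cardinality are both twice those of the half, so the two factors
    -- cancel.
    rw [sum_frequencies_of_even hE _ fun l _ => by simp [pairing], card_frequencies hE, hm,
      ← Finset.sum_coe_sort, ← e.sum_comp] at h1
    simp_rw [hin, mul_pow]
    rw [← Finset.mul_sum, Real.sq_sqrt (by positivity)]
    have h2 : ∑ i, pairing (e i : Fin (k + 1) → ℤ) y ^ 2 =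
        (m + 1 : ℕ) * E / (k + 1 : ℕ) * ‖y‖ ^ 2 := by
      push_cast at h1 ⊢
      linear_combination h1 / 2
    rw [h2]
    ring
  rw [hZ]
  refine ⟨hF.comp_aemeasurable hlaw.aemeasurable, ?_⟩
  rw [hlaw.lintegral_comp hF.aemeasurable]
  simp only [F]
  rw [lintegral_zeros_wave finrank_euclideanSpace_fin l monotone_compactCube isCompact_compactCube
    (by rw [hvol]; exact ENNReal.one_ne_top), hvol, mul_one,
    ← lintegral_map (f := fun x => ‖x‖ₑ) (by fun_prop) (by fun_prop),
    map_sum_smul_pi_gaussian l hiso, lintegral_map (by fun_prop) (by fun_prop)]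
  simp_rw [enorm_smul]
  rw [lintegral_const_mul' _ _ enorm_ne_top, lintegral_enorm_stdGaussian,
    Real.enorm_eq_ofReal (by positivity), ← ENNReal.ofReal_mul (by positivity),
    ← ENNReal.ofReal_mul (by positivity), ← nodalConstant_mul_sqrt (Nat.succ_ne_zero k)
      (Nat.succ_ne_zero m) E]
  push_cast
  rfl

end Lattice

end ToralNodal

theorem mainTheorem2 {Ω : Type*} [MeasurableSpace Ω] (P : Measure Ω) [IsProbabilityMeasure P]
    (d E : ℕ) (hd : 1 ≤ d) (hE : E ≠ 0) (hN : (ToralNodal.frequencies d E).Nonempty)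
    (b c : (Fin d → ℤ) → Ω → ℝ) (hbc : ToralNodal.IsGaussianCoefficients P d E b c) :
    AEMeasurable (fun ω => ToralNodal.nodalVolume d E (fun l => b l ω) (fun l => c l ω)) P ∧
    ∫⁻ ω, ToralNodal.nodalVolume d E (fun l => b l ω) (fun l => c l ω) ∂P =
      ENNReal.ofReal (ToralNodal.nodalConstant d * √(E : ℝ)) := by
  exact ToralNodal.lintegral_nodalVolume P d E hd hE hN b c hbc
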